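/- **Setting.** Fix constants $M_\mu>0$, $c_w\in(0,1/2)$ and $c_\Sigma>1$. Let $\overline\Theta$ be the set of all $\overline\theta=(w,\mu_1,\mu_2,\Sigma)$ with $\mu_1,\mu_2\in\mathbb R^p$, $\|\mu_1\|_2\vee\|\mu_2\|_2\le M_\mu$, $w\in(c_w,1-c_w)$ and $\Sigma\in\mathbb R^{p\times p}$ symmetric with $c_\Sigma^{-1}\le\lambda_{\min}(\Sigma)\le\lambda_{\max}(\Sigma)\le c_\Sigma$. Put $\beta=\Sigma^{-1}(\mu_1-\mu_2)$ and $\theta=(w,\mu_1,\mu_2,\beta)$. For non-empty $S\subseteq\{1,\dots,K\}$ and $h_w,h_\mu,h_\beta\ge 0$ let $\overline\Theta_S(h_w,h_\mu,h_\beta)$ be the set of families $\{\overline\theta^{(k)}\}_{k\in S}$ in $\overline\Theta$ with $\inf_{w}\max_{k\in S}|w^{(k)}-w|\le h_w$, $\inf_{\mu}\max_{k\in S}\|\mu_j^{(k)}-\mu\|_2\le h_\mu$ for $j=1,2$, and $\inf_{\beta}\max_{k\in S}\|\beta^{(k)}-\beta\|_2\le h_\beta$. There are $K\ge1$ tasks,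 with $n_k\ge 1$ observations in $\mathbb R^p$ ($p\ge1$) from task $k$. For $S\subseteq\{1,\dots,K\}$, $\{\overline\theta^{(k)*}\}_{k\in S}$ and a probability measure $\mathbb Q_S$ on $(\mathbb R^p)^{n_{S^c}}$, $n_{S^c}=\sum_{k\notin S}n_k$, let $\mathbb P$ be the law of the data under which the observations of the tasks in $S$ are independent, those of task $k\in S$ having law $(1-w^{(k)*})\mathcal N(\mu_1^{(k)*},\Sigma^{(k)*})+w^{(k)*}\mathcal N(\mu_2^{(k)*},\Sigma^{(k)*})$, and the data of the tasks outside $S$ are independent of these and have joint law $\mathbb Q_S$. Write $n_S=\sum_{k\in S}n_k$, and $$d(\theta,\theta')=|w-w'|\vee\|\mu_1-\mu_1'\|_2\vee\|\mu_2-\mu_2'\|_2\vee\|\beta-\beta'\|_2 .$$ **Theorem.** There exist constants $c,C,C_1>0$, depending only on $M_\mu,c_w,c_\Sigma$, such that the following holds for all $p$, $K$, $1\le s\le K$, $\{n_k\}_{k=1}^K$ and $h_w,h_\mu,h_\beta\ge 0$. Suppose that $\epsilon:=\frac{K-s}{s}<c$ and that there is a subset $S$ with $|S|\ge s$ and $\min_{k\in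 S}n_k\ge C(p+\log K)$. Then $$\inf_{\{\widehat\theta^{(k)}\}_{k=1}^K}\ \sup_{S:|S|\ge s}\ \sup_{\substack{\{\overline\theta^{(k)*}\}_{k\in S}\in\overline\Theta_S(h_w,h_\mu,h_\beta)\\ \mathbb Q_S}}\mathbb P\Bigg(\bigcup_{k\in S}\Big\{d(\widehat\theta^{(k)},\theta^{(k)*})\ge C_1\Big[\sqrt{\tfrac{p}{n_S}}+\tfrac{\epsilon}{\sqrt{\max_{1\le k\le K}n_k}}+\min\Big\{h_w,\sqrt{\tfrac{1+\log K}{n_k}}\Big\}+\min\Big\{h_\mu,\sqrt{\tfrac{p+\log K}{n_k}}\Big\}+\min\Big\{h_\beta,\sqrt{\tfrac{p+\log K}{n_k}}\Big\}\Big]\Big\}\Bigg)\ge\frac1{10}$$ and $$\inf_{\{\widehat\Sigma^{(k)}\}_{k=1}^K}\ \sup_{S:|S|\ge s}\ \sup_{\substack{\{\overline\theta^{(k)*}\}_{k\in S}\in\overline\Theta_S(h_w,h_\mu,h_\beta)\\ \mathbb Q_S}}\mathbb P\Bigg(\bigcup_{k\in S}\Big\{\|\widehat\Sigma^{(k)}-\Sigma^{(k)*}\|_2\ge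 C_1\sqrt{\tfrac{p+\log K}{n_k}}\Big\}\Bigg)\ge\frac1{10},$$ where the infima are over all estimators, that is, all measurable functions of the complete data of the $K$ tasks with values in $\mathbb R\times\mathbb R^p\times\mathbb R^p\times\mathbb R^p$, respectively in $\mathbb R^{p\times p}$, and $\|\cdot\|_2$ of a matrix is the spectral norm. -/

import Mathlib

open MeasureTheory ProbabilityTheory
open scoped ENNReal

namespace MultiTaskGMM

noncomputable section

/-- The parameters `(w, μ₁, μ₂, Σ)` of a binary Gaussian mixture model on `ℝᵖ` with common
covariance matrix. -/
@[ext]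
structure GMMParam (p : ℕ) where
  w : ℝ
  μ₁ : EuclideanSpace ℝ (Fin p)
  μ₂ : EuclideanSpace ℝ (Fin p)
  cov : Matrix (Fin p) (Fin p) ℝ

/-- Tuples `(w, μ₁, μ₂, β)`, with `β` in the role of the discriminant coefficient. -/
abbrev DiscParam (p : ℕ) : Type :=
  ℝ × EuclideanSpace ℝ (Fin p) × EuclideanSpace ℝ (Fin p) × EuclideanSpace ℝ (Fin p)

/-- The discriminant coefficient `β = Σ⁻¹ (μ₁ - μ₂)`. -/
def GMMParam.beta {p : ℕ} (θ : GMMParam p) : EuclideanSpace ℝ (Fin p) :=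
  Matrix.toEuclideanLin θ.cov⁻¹ (θ.μ₁ - θ.μ₂)

/-- The tuple `(w, μ₁, μ₂, β)` attached to `(w, μ₁, μ₂, Σ)`. -/
def GMMParam.disc {p : ℕ} (θ : GMMParam p) : DiscParam p :=
  (θ.w, θ.μ₁, θ.μ₂, θ.beta)

/-- The law `(1 - w) N(μ₁, Σ) + w N(μ₂, Σ)` of one observation. -/
def GMMParam.law {p : ℕ} (θ : GMMParam p) : Measure (EuclideanSpace ℝ (Fin p)) :=
  ENNReal.ofReal (1 - θ.w) • multivariateGaussian θ.μ₁ θ.cov +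
    ENNReal.ofReal θ.w • multivariateGaussian θ.μ₂ θ.cov

/-- The distance between two tuples `(w, μ₁, μ₂, β)`: the maximum of the four (absolute value
or Euclidean) distances between the components. -/
def paramDist {p : ℕ} (a b : DiscParam p) : ℝ :=
  max |a.1 - b.1| (max ‖a.2.1 - b.2.1‖ (max ‖a.2.2.1 - b.2.2.1‖ ‖a.2.2.2 - b.2.2.2‖))

/-- The spectral norm of a square matrix. -/
def specNorm {p : ℕ} (A : Matrix (Fin p) (Fin p) ℝ) : ℝ :=
  ‖Matrix.toEuclideanCLM (n := Fin p) (𝕜 := ℝ) A‖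

/-- The parameter space of a single GMM: both means have norm at most `M`, the mixture proportion
lies in `(cw, 1 - cw)`, and the covariance matrix is symmetric with all eigenvalues in
`[cS⁻¹, cS]`. -/
def singleSpace (p : ℕ) (M cw cS : ℝ) : Set (GMMParam p) :=
  {θ | max ‖θ.μ₁‖ ‖θ.μ₂‖ ≤ M ∧ θ.w ∈ Set.Ioo cw (1 - cw) ∧
    ∃ hS : θ.cov.IsHermitian, ∀ i, cS⁻¹ ≤ hS.eigenvalues i ∧ hS.eigenvalues i ≤ cS}

/-- `inf_v max_i ‖x i - v‖`, for a finite family of points. -/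
def radius {ι E : Type*} [NormedAddCommGroup E] (x : ι → E) : ℝ :=
  ⨅ v : E, ⨆ i, ‖x i - v‖

/-- The joint parameter space of the tasks in `S`: every single parameter lies in the single-task
space, and the mixture proportions, the two means and the discriminant coefficients have radii at
most `hw`, `hμ`, `hμ` and `hβ`. -/
def jointSpace {p K : ℕ} (M cw cS : ℝ) (S : Finset (Fin K)) (hw hμ hβ : ℝ) :
    Set ({k // k ∈ S} → GMMParam p) :=
  {θ | (∀ k, θ k ∈ singleSpace p M cw cS) ∧
    radius (fun k => (θ k).w) ≤ hw ∧
    max (radius fun k => (θ k).μ₁) (radius fun k => (θ k).μ₂) ≤ hμ ∧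
    radius (fun k => (θ k).beta) ≤ hβ}

/-- The complete data: `n k` observations in `ℝᵖ` for each task `k`. -/
abbrev Data (p : ℕ) {K : ℕ} (n : Fin K → ℕ) : Type :=
  (k : Fin K) → Fin (n k) → EuclideanSpace ℝ (Fin p)

/-- The data of the tasks outside `S`. -/
abbrev OutlierData (p : ℕ) {K : ℕ} (n : Fin K → ℕ) (S : Finset (Fin K)) : Type :=
  (k : {k // k ∉ S}) → Fin (n k) → EuclideanSpace ℝ (Fin p)

/-- The law of the complete data: all observations of the tasks in `S` are independent, those of
task `k` following the GMM with parameter `θ k`; the data of the tasks outside `S` have the joint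
law `Q` and are independent of the data of the tasks in `S`. -/
def dataLaw {p K : ℕ} (n : Fin K → ℕ) (S : Finset (Fin K)) (θ : {k // k ∈ S} → GMMParam p)
    (Q : Measure (OutlierData p n S)) : Measure (Data p n) :=
  ((Measure.pi fun k : {k // k ∈ S} => Measure.pi fun _ : Fin (n k) => (θ k).law).prod Q).map
    (MeasurableEquiv.piEquivPiSubtypeProd
      (fun k : Fin K => Fin (n k) → EuclideanSpace ℝ (Fin p)) (fun k => k ∈ S)).symm

/-- The rate, for task `k ∈ S`, of the estimation error of `(w, μ₁, μ₂, β)`. -/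
def rate {K : ℕ} (p s : ℕ) (n : Fin K → ℕ) (hw hμ hβ : ℝ) (S : Finset (Fin K)) (k : Fin K) : ℝ :=
  √((p : ℝ) / ((∑ j ∈ S, n j : ℕ) : ℝ)) +
    (((K : ℝ) - s) / s) / √((Finset.univ.sup n : ℕ) : ℝ) +
    min hw (√((1 + Real.log K) / n k)) +
    min hμ (√((p + Real.log K) / n k)) +
    min hβ (√((p + Real.log K) / n k))

end

end MultiTaskGMM

open MultiTaskGMM

/-! For each task the rate is at most five times its largest summand, so it suffices to produce one
bad configuration for whichever summand dominates. Indistinguishability is measured throughout by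
the χ² divergence, kept in the dual form `ChiBound`, which passes through products, mixtures with
common weights and push-forwards with little effort. Three mechanisms occur.

Testing many hypotheses: if N ≥ 2 laws have χ² bound at most √N against a common reference, no
family of disjoint events can catch each law with probability above 9/10
(`ChiBound.exists_le_compl`, `exists_le_dataLaw`). Shifting the means of all tasks together along
2^p packed directions uses all n_S observations and gives √(p/n_S) (`exists_le_dataLaw_common`).

Perturbing one unknown task j in one direction v: the pairs (j, v) number about K·2^p, so each task
may move by a multiple of √((p + log K)/n_k), clipped at h to stay in the joint space
(`exists_le_dataLaw_single`). For the proportion there are only two directions, whence 1 + log K.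
For β and Σ the precision matrix is moved by a matrix of rank at most two, whose χ² cost does not
depend on p. With both means zero, β vanishes and Σ moves without any similarity constraint, so its
rate is not clipped.

Contamination: two parameters common to all tasks whose n_k-sample laws are within total variation η
become identical when each task is replaced, independently and with probability η, by suitable
outliers. This random contamination is a mixture of admissible models over the random set S of good
tasks, so no estimator can serve both parameters (`exists_contamination`,
`exists_le_dataLaw_contaminated`). As η is of order ε, this gives ε/√(max n_k). -/

open MultiTaskGMM

/-! ### χ² bounds in dual form and their consequences for testing -/

/-- `B` bounds `1 + χ²(P ‖ Q)`, in dual form. -/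
def ChiBound {α : Type*} [MeasurableSpace α] (P Q : Measure α) (B : ℝ≥0∞) : Prop :=
  ∀ h : α → ℝ≥0∞, Measurable h → (∫⁻ x, h x ∂P) ^ 2 ≤ B * ∫⁻ x, h x ^ 2 ∂Q

namespace ChiBound

variable {α β : Type*} [MeasurableSpace α] [MeasurableSpace β]

lemma mono {P Q : Measure α} {B B' : ℝ≥0∞} (h : ChiBound P Q B) (hB : B ≤ B') :
    ChiBound P Q B' := fun f hf => (h f hf).trans (by gcongr)

lemma map {P Q : Measure α} {B : ℝ≥0∞} (h : ChiBound P Q B) {g : α → β} (hg : Measurable g) :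
    ChiBound (P.map g) (Q.map g) B := by
  intro f hf
  rw [lintegral_map hf hg, lintegral_map (hf.pow_const 2) hg]
  exact h _ (hf.comp hg)

/-- Cauchy–Schwarz applied to f h ≤ √(B g h²) · √e. The optimal e is f²/(Bg); for Gaussian densities
it is again a Gaussian density, so its integral is known without computation. -/
lemma of_density {ν : Measure α} {f g e : α → ℝ≥0∞} {B : ℝ≥0∞}
    (hf : Measurable f) (hg : Measurable g) (he : Measurable e)
    (hfge : ∀ x, f x ^ 2 ≤ B * g x * e x) (he1 : ∫⁻ x, e x ∂ν ≤ 1) :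
    ChiBound (ν.withDensity f) (ν.withDensity g) B := by
  intro h hh
  rw [lintegral_withDensity_eq_lintegral_mul _ hf hh,
    lintegral_withDensity_eq_lintegral_mul _ hg (hh.pow_const 2)]
  have hr : ∀ a : ℝ≥0∞, (a ^ (1 / 2 : ℝ)) ^ 2 = a := fun a => by
    rw [← ENNReal.rpow_natCast, ← ENNReal.rpow_mul]; norm_num
  have hr' : ∀ a : ℝ≥0∞, (a ^ 2) ^ (1 / 2 : ℝ) = a := fun a => by
    rw [← ENNReal.rpow_natCast, ← ENNReal.rpow_mul]; norm_num
  set u : α → ℝ≥0∞ := fun x => (B * (g x * h x ^ 2)) ^ (1 / 2 : ℝ) with hu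
  set v : α → ℝ≥0∞ := fun x => (e x) ^ (1 / 2 : ℝ) with hv
  have hum : Measurable u := by fun_prop
  have hvm : Measurable v := by fun_prop
  have h1 : ∫⁻ x, (f * h) x ∂ν ≤ ∫⁻ x, (u * v) x ∂ν := by
    refine lintegral_mono fun x => ?_
    simp only [Pi.mul_apply, hu, hv]
    rw [← ENNReal.mul_rpow_of_nonneg _ _ (by norm_num), ← hr' (f x * h x)]
    gcongr
    calc (f x * h x) ^ 2 = f x ^ 2 * h x ^ 2 := by ring
      _ ≤ B * g x * e x * h x ^ 2 := by gcongr; exact hfge x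
      _ = _ := by ring
  have h2 := ENNReal.lintegral_mul_le_Lp_mul_Lq ν Real.HolderConjugate.two_two
    hum.aemeasurable hvm.aemeasurable
  have h3 : ∀ a : ℝ≥0∞, a ^ (2 : ℝ) = a ^ 2 := fun a => by
    rw [← ENNReal.rpow_natCast]; norm_num
  simp only [h3] at h2
  calc (∫⁻ x, (f * h) x ∂ν) ^ 2 ≤ (∫⁻ x, (u * v) x ∂ν) ^ 2 := by gcongr
    _ ≤ ((∫⁻ x, u x ^ 2 ∂ν) ^ (1 / 2 : ℝ) * (∫⁻ x, v x ^ 2 ∂ν) ^ (1 / 2 : ℝ)) ^ 2 := by gcongr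
    _ = (∫⁻ x, u x ^ 2 ∂ν) * (∫⁻ x, v x ^ 2 ∂ν) := by rw [mul_pow, hr, hr]
    _ ≤ (∫⁻ x, u x ^ 2 ∂ν) * 1 := by
        gcongr
        simpa only [hv, hr] using he1
    _ = _ := by
        simp only [hu, hr, mul_one]
        rw [lintegral_const_mul _ (by fun_prop)]
        rfl

lemma refl (P : Measure α) [IsProbabilityMeasure P] : ChiBound P P 1 := by
  have := of_density (ν := P) (f := fun _ => 1) (g := fun _ => 1) (e := fun _ => 1) (B := 1)
    measurable_const measurable_const measurable_const (by simp) (by simp)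
  simpa using this

/-- Convexity of the square; it works because both mixtures carry the same weights. -/
lemma smul_add_smul {P₁ P₂ Q₁ Q₂ : Measure α} {B a b : ℝ≥0∞} (h₁ : ChiBound P₁ Q₁ B)
    (h₂ : ChiBound P₂ Q₂ B) (hab : a + b = 1) :
    ChiBound (a • P₁ + b • P₂) (a • Q₁ + b • Q₂) B := by
  intro f hf
  simp only [lintegral_add_measure, lintegral_smul_measure, smul_eq_mul]
  have h3 : ∀ a : ℝ≥0∞, a ^ (2 : ℝ) = a ^ 2 := fun a => by
    rw [← ENNReal.rpow_natCast]; norm_num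
  have := ENNReal.rpow_arith_mean_le_arith_mean2_rpow a b (∫⁻ x, f x ∂P₁) (∫⁻ x, f x ∂P₂) hab
    (p := 2) (by norm_num)
  simp only [h3] at this
  calc _ ≤ _ := this
    _ ≤ a * (B * ∫⁻ x, f x ^ 2 ∂Q₁) + b * (B * ∫⁻ x, f x ^ 2 ∂Q₂) := by
      gcongr
      exacts [h₁ f hf, h₂ f hf]
    _ = _ := by ring

lemma prod {P₁ Q₁ : Measure α} {P₂ Q₂ : Measure β} [SFinite P₂] [SFinite Q₂]
    {B₁ B₂ : ℝ≥0∞} (h₁ : ChiBound P₁ Q₁ B₁) (h₂ : ChiBound P₂ Q₂ B₂) :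
    ChiBound (P₁.prod P₂) (Q₁.prod Q₂) (B₁ * B₂) := by
  intro f hf
  rw [lintegral_prod _ hf.aemeasurable, lintegral_prod _ (hf.pow_const 2).aemeasurable]
  calc _ ≤ B₁ * ∫⁻ x, (∫⁻ y, f (x, y) ∂P₂) ^ 2 ∂Q₁ := h₁ _ hf.lintegral_prod_right'
    _ ≤ B₁ * ∫⁻ x, B₂ * ∫⁻ y, f (x, y) ^ 2 ∂Q₂ ∂Q₁ := by
      gcongr with x
      exact h₂ _ (hf.comp measurable_prodMk_left)
    _ = _ := by
      rw [lintegral_const_mul _ (hf.pow_const 2).lintegral_prod_right']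
      ring

lemma pi {ι : Type*} [Fintype ι] {X : ι → Type*} [∀ i, MeasurableSpace (X i)]
    {P Q : ∀ i, Measure (X i)} [∀ i, SigmaFinite (P i)] [∀ i, SigmaFinite (Q i)]
    {B : ι → ℝ≥0∞} (h : ∀ i, ChiBound (P i) (Q i) (B i)) :
    ChiBound (Measure.pi P) (Measure.pi Q) (∏ i, B i) := by
  classical
  intro f hf
  -- Coordinates are integrated out one at a time, the others being frozen at x.
  have key : ∀ (s : Finset ι) (x : ∀ i, X i),
      (lmarginal P s f x) ^ 2 ≤ (∏ i ∈ s, B i) * lmarginal Q s (fun y => f y ^ 2) x := by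
    intro s
    induction s using Finset.induction_on with
    | empty => intro x; simp
    | insert i s his ih =>
      intro x
      have hm : Measurable (lmarginal Q s fun y => f y ^ 2) := (hf.pow_const 2).lmarginal Q
      rw [lmarginal_insert f hf his, lmarginal_insert _ (hf.pow_const 2) his,
        Finset.prod_insert his]
      calc _ ≤ B i * ∫⁻ y, (lmarginal P s f (Function.update x i y)) ^ 2 ∂Q i :=
            h i _ ((hf.lmarginal P).comp (measurable_update x))
        _ ≤ B i * ∫⁻ y, (∏ j ∈ s, B j) *
              lmarginal Q s (fun y => f y ^ 2) (Function.update x i y) ∂Q i := by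
            gcongr with y
            exact ih _
        _ = _ := by
            have hm' : Measurable fun y =>
                lmarginal Q s (fun y => f y ^ 2) (Function.update x i y) :=
              hm.comp (measurable_update x)
            rw [lintegral_const_mul _ hm']
            ring
  rcases isEmpty_or_nonempty (∀ i, X i) with hX | ⟨⟨x⟩⟩
  · simp [Measure.eq_zero_of_isEmpty]
  · simpa only [lmarginal_univ] using key Finset.univ x

lemma apply {P Q : Measure α} {B : ℝ≥0∞} (h : ChiBound P Q B) {A : Set α}
    (hA : MeasurableSet A) : P A ^ 2 ≤ B * Q A := by
  have := h (A.indicator 1) (measurable_one.indicator hA)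
  have h2 : ∀ x, (A.indicator (1 : α → ℝ≥0∞) x) ^ 2 = A.indicator 1 x := by
    intro x; by_cases hx : x ∈ A <;> simp [hx]
  simpa only [h2, lintegral_indicator_one hA] using this

/-- Two probability measures with small `χ²` divergence are close in total variation. -/
lemma real_apply_le {P Q : Measure α} [IsProbabilityMeasure P] [IsProbabilityMeasure Q] {y : ℝ}
    (hy : 0 ≤ y) (hy1 : y ≤ 1) (h : ChiBound P Q (ENNReal.ofReal (1 + y ^ 2))) {A : Set α}
    (hA : MeasurableSet A) : P.real A ≤ Q.real A + y := by
  set q := Q.real A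
  set p := P.real A
  have hq0 : 0 ≤ q := measureReal_nonneg
  have hq1 : q ≤ 1 := measureReal_le_one
  have hp0 : 0 ≤ p := measureReal_nonneg
  -- The test function is 1 + t(1_A − q), which has Q-mean one and Q-variance t² q(1 − q).
  have key : ∀ t : ℝ, 0 ≤ t → t ≤ 1 → (1 + t * (p - q)) ^ 2 ≤
      (1 + y ^ 2) * (1 + t ^ 2 * (q * (1 - q))) := by
    intro t ht ht1
    have ha : 0 ≤ 1 - t * q := by nlinarith
    have hm : Measurable fun x => ENNReal.ofReal (1 - t * q) +
        A.indicator (fun _ => ENNReal.ofReal t) x :=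
      (measurable_const.indicator hA).const_add _
    have := h _ hm
    have h2 : ∀ x, (ENNReal.ofReal (1 - t * q) + A.indicator (fun _ => ENNReal.ofReal t) x) ^ 2
        = ENNReal.ofReal ((1 - t * q) ^ 2) +
          A.indicator (fun _ => ENNReal.ofReal (2 * (1 - t * q) * t + t ^ 2)) x := by
      intro x
      by_cases hx : x ∈ A
      · simp only [hx, Set.indicator_of_mem]
        rw [← ENNReal.ofReal_add ha ht, ← ENNReal.ofReal_pow (by positivity),
          ← ENNReal.ofReal_add (by positivity) (by positivity)]
        congr 1; ring
      · simp [hx, ENNReal.ofReal_pow ha]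
    simp only [h2] at this
    rw [lintegral_add_left measurable_const, lintegral_add_left measurable_const,
      lintegral_indicator_const hA, lintegral_indicator_const hA] at this
    simp only [lintegral_const, measure_univ, mul_one] at this
    rw [← ofReal_measureReal (μ := P) (s := A), ← ofReal_measureReal (μ := Q) (s := A),
      ← ENNReal.ofReal_mul ht, ← ENNReal.ofReal_mul (by positivity),
      ← ENNReal.ofReal_add ha (by positivity), ← ENNReal.ofReal_add (by positivity) (by positivity),
      ← ENNReal.ofReal_pow (by positivity), ← ENNReal.ofReal_mul (by positivity),
      ENNReal.ofReal_le_ofReal_iff (by positivity)] at this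
    calc _ = (1 - t * q + t * p) ^ 2 := by ring
      _ ≤ _ := this
      _ = _ := by ring
  have hk := key y hy hy1
  by_contra! hlt
  have hqq : q * (1 - q) ≤ 1 / 4 := by nlinarith [sq_nonneg (q - 1 / 2)]
  have h5 : (1 + y * (p - q)) ^ 2 ≤ (1 + y ^ 2) * (1 + y ^ 2 * (1 / 4)) := by
    refine hk.trans ?_
    gcongr
  have h6 : y ^ 2 ≤ y * (p - q) := by nlinarith
  -- The choice t = y carries no information when y = 0; there t = (p − q)/2 gives the
  -- contradiction.
  rcases hy.eq_or_lt with rfl | hy0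
  · have h7 := key ((p - q) / 2) (by linarith) (by
      have : p ≤ 1 := measureReal_le_one
      linarith)
    have : 0 < p - q := by linarith
    nlinarith [sq_nonneg (p - q), mul_pos this this]
  · have h8 : (1 + y ^ 2) ^ 2 ≤ (1 + y * (p - q)) ^ 2 := by gcongr
    have h9 : (1 + y ^ 2) ≤ (1 + y ^ 2 * (1 / 4)) := by
      have : 0 < 1 + y ^ 2 := by positivity
      nlinarith
    nlinarith

/-- If the hypotheses `P i` are close to `Q` in comparison with their number, no test identifies
all of them. -/
lemma exists_le_compl {ι : Type*} [Fintype ι] {P : ι → Measure α} {Q : Measure α}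
    [∀ i, IsProbabilityMeasure (P i)] [IsProbabilityMeasure Q] {B : ℝ}
    (hB : 0 ≤ B) (hcard : 2 ≤ Fintype.card ι) (hBc : B ^ 2 ≤ Fintype.card ι)
    (h : ∀ i, ChiBound (P i) Q (ENNReal.ofReal B)) {A : ι → Set α}
    (hA : ∀ i, MeasurableSet (A i)) (hd : Pairwise (Function.onFun Disjoint A)) :
    ∃ i, (1 / 10 : ℝ≥0∞) ≤ P i (A i)ᶜ := by
  by_contra! hcon
  have h1 : ∀ i, (81 / 100 : ℝ) ≤ B * Q.real (A i) := by
    intro i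
    have h2 : (P i).real (A i)ᶜ < 1 / 10 := by
      have := (ENNReal.toReal_lt_toReal (by simp) (by simp)).2 (hcon i)
      simpa [Measure.real] using this
    rw [probReal_compl_eq_one_sub (hA i)] at h2
    have h3 := (ENNReal.toReal_le_toReal (by simp) (ENNReal.mul_ne_top (by simp) (by simp))).2
      ((h i).apply (hA i))
    rw [ENNReal.toReal_pow, ENNReal.toReal_mul, ENNReal.toReal_ofReal hB] at h3
    change (P i).real (A i) ^ 2 ≤ B * Q.real (A i) at h3
    nlinarith
  have h4 : ∑ i, Q.real (A i) ≤ 1 := by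
    rw [← measureReal_iUnion_fintype hd hA]
    exact measureReal_le_one
  -- Together with B² ≤ N this forces 0.81 · √N ≤ 1, which is false for N ≥ 2.
  have h5 : (Fintype.card ι : ℝ) * (81 / 100) ≤ B := by
    calc (Fintype.card ι : ℝ) * (81 / 100) = ∑ i : ι, (81 / 100 : ℝ) := by simp
      _ ≤ ∑ i, B * Q.real (A i) := Finset.sum_le_sum fun i _ => h1 i
      _ = B * ∑ i, Q.real (A i) := by rw [Finset.mul_sum]
      _ ≤ B * 1 := by gcongr
      _ = B := mul_one B
  have hc : (2 : ℝ) ≤ Fintype.card ι := by exact_mod_cast hcard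
  nlinarith

end ChiBound

/-! ### Contamination and random subsets -/

/-- Two probability measures at total variation distance at most `η` become equal after suitable
contaminations of proportion `η`. -/
lemma exists_contamination {α : Type*} [MeasurableSpace α] (P P' : Measure α)
    [IsProbabilityMeasure P] [IsProbabilityMeasure P'] {η : ℝ} (h0 : 0 < η) (h1 : η < 1)
    (h : ∀ A, MeasurableSet A → P'.real A ≤ P.real A + η) :
    ∃ q q' : Measure α, IsProbabilityMeasure q ∧ IsProbabilityMeasure q' ∧
      ENNReal.ofReal (1 - η) • P + ENNReal.ofReal η • q =
        ENNReal.ofReal (1 - η) • P' + ENNReal.ofReal η • q' := by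
  obtain ⟨s, hs⟩ := exists_isHahnDecomposition P P'
  have hsm := hs.measurableSet
  -- The supremum of P and P', whose mass is one plus their total variation distance.
  set m₀ : Measure α := P'.restrict s + P.restrict sᶜ with hm₀
  have hP : P ≤ m₀ := by
    rw [← Measure.restrict_add_restrict_compl (μ := P) hsm]
    exact add_le_add hs.le_on le_rfl
  have hP' : P' ≤ m₀ := by
    rw [← Measure.restrict_add_restrict_compl (μ := P') hsm]
    exact add_le_add le_rfl hs.ge_on_compl
  have hmass : m₀.real Set.univ ≤ 1 + η := by
    have : m₀.real Set.univ = P'.real s + P.real sᶜ := by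
      simp [hm₀, measureReal_def, ENNReal.toReal_add]
    rw [this, probReal_compl_eq_one_sub hsm]
    linarith [h s hsm]
  have hmass1 : 1 ≤ m₀.real Set.univ := by
    have := (ENNReal.toReal_le_toReal (measure_ne_top P Set.univ)
      (measure_ne_top m₀ Set.univ)).2 (hP Set.univ)
    simpa [measureReal_def] using this
  set c := m₀.real Set.univ with hc
  set m : Measure α := ENNReal.ofReal c⁻¹ • m₀ with hm
  -- Since (1 − η)(1 + η) ≤ 1, the normalised supremum m dominates both (1 − η)P and (1 − η)P'; each
  -- remainder has mass η and supplies the contamination.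
  have hcm : ENNReal.ofReal (1 - η) ≤ ENNReal.ofReal c⁻¹ := by
    apply ENNReal.ofReal_le_ofReal
    rw [le_inv_comm₀ (by linarith) (by linarith), ← one_div, le_div_iff₀ (by linarith)]
    nlinarith
  have hmuniv : m Set.univ = 1 := by
    rw [hm, Measure.smul_apply, smul_eq_mul, ← ofReal_measureReal (μ := m₀), ← hc,
      ← ENNReal.ofReal_mul (by positivity), inv_mul_cancel₀ (by linarith), ENNReal.ofReal_one]
  have : IsProbabilityMeasure m := ⟨hmuniv⟩
  have key : ∀ R : Measure α, IsProbabilityMeasure R → R ≤ m₀ → ∃ q : Measure α,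
      IsProbabilityMeasure q ∧ ENNReal.ofReal (1 - η) • R + ENNReal.ofReal η • q = m := by
    intro R hR hRm
    have hle : ENNReal.ofReal (1 - η) • R ≤ m := by
      intro A
      simp only [hm, Measure.smul_apply, smul_eq_mul]
      gcongr
    have hfin : IsFiniteMeasure (ENNReal.ofReal (1 - η) • R) :=
      Measure.smul_finite R ENNReal.ofReal_ne_top
    have hη : ENNReal.ofReal η ≠ 0 := by simpa using h0
    refine ⟨(ENNReal.ofReal η)⁻¹ • (m - ENNReal.ofReal (1 - η) • R), ⟨?_⟩, ?_⟩
    · rw [Measure.smul_apply, Measure.sub_apply MeasurableSet.univ hle, hmuniv]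
      simp only [Measure.smul_apply, measure_univ, smul_eq_mul, mul_one]
      rw [← ENNReal.ofReal_one, ← ENNReal.ofReal_sub _ (by linarith), sub_sub_cancel,
        ENNReal.ofReal_one, ENNReal.inv_mul_cancel hη ENNReal.ofReal_ne_top]
    · rw [smul_smul, ENNReal.mul_inv_cancel hη ENNReal.ofReal_ne_top, one_smul, add_comm,
        Measure.sub_add_cancel_of_le hle]
  obtain ⟨q, hq, hq1⟩ := key P inferInstance hP
  obtain ⟨q', hq', hq1'⟩ := key P' inferInstance hP'
  exact ⟨q, q', hq, hq', hq1.trans hq1'.symm⟩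

/-- The product of mixtures is a mixture of products. -/
lemma pi_smul_add_smul {ι : Type*} [Fintype ι] [DecidableEq ι] {X : ι → Type*}
    [∀ i, MeasurableSpace (X i)] (P q : ∀ i, Measure (X i)) [∀ i, IsProbabilityMeasure (P i)]
    [∀ i, IsProbabilityMeasure (q i)] {a b : ℝ≥0∞} (ha : a ≠ ∞) (hb : b ≠ ∞) :
    Measure.pi (fun i => a • P i + b • q i) =
      ∑ S : Finset ι, (a ^ S.card * b ^ (Fintype.card ι - S.card)) •
        Measure.pi fun i => if i ∈ S then P i else q i := by
  have : ∀ i, IsFiniteMeasure (a • P i) := fun i => Measure.smul_finite _ ha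
  have : ∀ i, IsFiniteMeasure (b • q i) := fun i => Measure.smul_finite _ hb
  have : ∀ (S : Finset ι) i, IsProbabilityMeasure (if i ∈ S then P i else q i) := by
    intro S i; split_ifs <;> infer_instance
  refine Measure.pi_eq fun A hA => ?_
  simp only [Measure.add_apply, Measure.smul_apply, smul_eq_mul, Measure.coe_finsetSum,
    Finset.sum_apply, Measure.pi_pi]
  rw [Finset.prod_add, Finset.powerset_univ]
  refine Finset.sum_congr rfl fun S _ => ?_
  rw [Finset.prod_mul_distrib, Finset.prod_mul_distrib, Finset.prod_const, Finset.prod_const,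
    ← Finset.compl_eq_univ_sdiff, Finset.card_compl]
  have h1 : ∏ i, (if i ∈ S then P i else q i) (A i) =
      (∏ i ∈ S, P i (A i)) * ∏ i ∈ Sᶜ, q i (A i) := by
    rw [← Finset.prod_mul_prod_compl S]
    congr 1
    · exact Finset.prod_congr rfl fun i hi => by simp [hi]
    · exact Finset.prod_congr rfl fun i hi => by simp [Finset.mem_compl.1 hi]
  rw [h1]
  ring

/-- The probability that a fixed point is missed by a random subset containing each point
independently with probability `1 - η`. -/
lemma sum_subsets_not_mem {ι : Type*} [Fintype ι] [DecidableEq ι] (η : ℝ) (k : ι) :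
    ∑ S : Finset ι with k ∉ S, (1 - η) ^ S.card * η ^ (Fintype.card ι - S.card) = η := by
  -- Replacing the factor 1 − η at k by zero kills exactly the subsets that contain k.
  have h := Finset.prod_add (fun i : ι => if i = k then (0 : ℝ) else 1 - η) (fun _ => η) Finset.univ
  have h1 : ∏ i : ι, ((if i = k then (0 : ℝ) else 1 - η) + η) = η := by
    rw [Fintype.prod_eq_single k]
    · simp
    · intro i hi; simp [hi]
  rw [h1, Finset.powerset_univ] at h
  refine Eq.trans ?_ h.symm
  rw [Finset.sum_filter]
  refine Finset.sum_congr rfl fun S _ => ?_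
  rw [Finset.prod_const, ← Finset.compl_eq_univ_sdiff, Finset.card_compl]
  by_cases hk : k ∈ S
  · rw [if_neg (not_not.2 hk), Finset.prod_eq_zero hk (by simp), zero_mul]
  · rw [if_pos hk, Finset.prod_congr rfl (g := fun _ => 1 - η), Finset.prod_const]
    intro i hi
    rw [if_neg]
    rintro rfl
    exact hk hi

/-- A random subset containing each point independently with probability `1 - η` contains a given
point and misses at most `m` points, up to probability `η + η n / (m + 1)`. -/
lemma sum_bad_subsets_le {ι : Type*} [Fintype ι] [DecidableEq ι] {η : ℝ} (h0 : 0 ≤ η)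
    (h1 : η ≤ 1) (k : ι) (m : ℕ) :
    ∑ S : Finset ι with ¬ (k ∈ S ∧ Sᶜ.card ≤ m),
      (1 - η) ^ S.card * η ^ (Fintype.card ι - S.card) ≤ η + Fintype.card ι * η / (m + 1) := by
  set w : Finset ι → ℝ := fun S => (1 - η) ^ S.card * η ^ (Fintype.card ι - S.card)
  have hw : ∀ S, 0 ≤ w S := fun S => mul_nonneg (pow_nonneg (by linarith) _) (pow_nonneg h0 _)
  have hs : ∀ j, ∑ S : Finset ι, (if j ∉ S then w S else 0) = η := fun j => by
    rw [← Finset.sum_filter]; exact sum_subsets_not_mem η j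
  have hm : (0 : ℝ) < m + 1 := by positivity
  calc ∑ S : Finset ι with ¬ (k ∈ S ∧ Sᶜ.card ≤ m), w S
      ≤ ∑ S : Finset ι, ((if k ∉ S then w S else 0) +
          (∑ j, if j ∉ S then w S else 0) / (m + 1)) := by
        rw [Finset.sum_filter]
        refine Finset.sum_le_sum fun S _ => ?_
        -- Markov's inequality for the number of missed points, whose mean is η times the number of
        -- points.
        have h2 : (∑ j, if j ∉ S then w S else 0) = Sᶜ.card * w S := by
          rw [← Finset.sum_filter, Finset.sum_const, nsmul_eq_mul]
          congr 3
          ext; simp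
        rw [h2]
        have h3 : 0 ≤ Sᶜ.card * w S / ((m : ℝ) + 1) := by have := hw S; positivity
        by_cases hk : k ∈ S
        · by_cases hc : Sᶜ.card ≤ m
          · simpa [hk, hc] using h3
          · simp only [hk, hc, and_false, not_false_eq_true, if_true, not_true_eq_false, if_false,
              zero_add]
            rw [le_div_iff₀ hm, mul_comm]
            have : (m : ℝ) + 1 ≤ Sᶜ.card := by exact_mod_cast not_le.1 hc
            exact mul_le_mul_of_nonneg_right this (hw S)
        · simpa [hk] using h3
    _ = η + Fintype.card ι * η / (m + 1) := by
        rw [Finset.sum_add_distrib, hs, ← Finset.sum_div, Finset.sum_comm]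
        simp only [hs, Finset.sum_const, Finset.card_univ, nsmul_eq_mul]

lemma sum_subsets {ι : Type*} [Fintype ι] [DecidableEq ι] (η : ℝ) :
    ∑ S : Finset ι, (1 - η) ^ S.card * η ^ (Fintype.card ι - S.card) = 1 := by
  rw [← Finset.powerset_univ]
  have := Finset.sum_pow_mul_eq_add_pow (1 - η) η (Finset.univ : Finset ι)
  simpa using this

/-! ### One-dimensional Gaussian χ² bounds -/

lemma chiBound_gaussianReal_of_pdf {m : ℝ} {v w : NNReal} {m' B : ℝ} (hv : v ≠ 0) (hw : w ≠ 0)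
    (hB : 0 ≤ B)
    (h : ∀ x, gaussianPDFReal m v x ^ 2 ≤ B * gaussianPDFReal 0 1 x * gaussianPDFReal m' w x) :
    ChiBound (gaussianReal m v) (gaussianReal 0 1) (ENNReal.ofReal B) := by
  rw [gaussianReal_of_var_ne_zero _ hv, gaussianReal_of_var_ne_zero _ one_ne_zero]
  refine ChiBound.of_density (e := gaussianPDF m' w) (measurable_gaussianPDF _ _)
    (measurable_gaussianPDF _ _) (measurable_gaussianPDF _ _) (fun x => ?_)
    (lintegral_gaussianPDF_eq_one _ hw).le
  simp only [gaussianPDF]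
  rw [← ENNReal.ofReal_pow (gaussianPDFReal_nonneg _ _ _), ← ENNReal.ofReal_mul hB,
    ← ENNReal.ofReal_mul (mul_nonneg hB (gaussianPDFReal_nonneg _ _ _))]
  exact ENNReal.ofReal_le_ofReal (h x)

lemma chiBound_gaussianReal_mean (m : ℝ) :
    ChiBound (gaussianReal m 1) (gaussianReal 0 1) (ENNReal.ofReal (Real.exp (m ^ 2))) := by
  -- Completing the square: the squared density with mean m, divided by the standard one, is a
  -- multiple of the density with mean 2m.
  refine chiBound_gaussianReal_of_pdf (m' := 2 * m) (w := 1) one_ne_zero one_ne_zero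
    (Real.exp_nonneg _) fun x => le_of_eq ?_
  simp only [gaussianPDFReal]
  rw [mul_pow, ← Real.exp_nat_mul]
  calc _ = (√(2 * Real.pi * (1 : NNReal)))⁻¹ ^ 2 * Real.exp (m ^ 2 + -(x - 0) ^ 2 / (2 * (1 : NNReal))
          + -(x - 2 * m) ^ 2 / (2 * (1 : NNReal))) := by
        congr 2; push_cast; ring
    _ = _ := by rw [Real.exp_add, Real.exp_add]; ring

/-- With u = a − 1 one has (1 + 2u²)(1 + 2u) − (1 + u)² = u²(1 + 4u), which is nonnegative exactly
from a = 3/4 on, apart from u = 0. -/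
lemma sqrt_ratio_bound {a : ℝ} (ha : 3 / 4 ≤ a) :
    a ≤ Real.exp ((a - 1) ^ 2) * √(2 * a - 1) := by
  have h1 : 1 + 2 * (a - 1) ^ 2 ≤ Real.exp (2 * (a - 1) ^ 2) := by
    linarith [Real.add_one_le_exp (2 * (a - 1) ^ 2)]
  have h2 : a ^ 2 ≤ Real.exp (2 * (a - 1) ^ 2) * (2 * a - 1) := by
    calc a ^ 2 ≤ (1 + 2 * (a - 1) ^ 2) * (2 * a - 1) := by
          have := mul_nonneg (sq_nonneg (a - 1)) (by linarith : 0 ≤ 4 * a - 3)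
          nlinarith
      _ ≤ _ := by gcongr; linarith
  refine abs_le_of_sq_le_sq' ?_ (by positivity) |>.2
  rw [mul_pow, Real.sq_sqrt (by linarith), ← Real.exp_nat_mul]
  exact_mod_cast h2

/-- Here a is the precision: squaring the density doubles it and dividing by the standard density
subtracts one, so the auxiliary Gaussian has precision 2a − 1 and the constant is a/√(2a − 1). -/
lemma chiBound_gaussianReal_var {a : ℝ} (ha : 3 / 4 ≤ a) :
    ChiBound (gaussianReal 0 (a⁻¹).toNNReal) (gaussianReal 0 1)
      (ENNReal.ofReal (Real.exp ((a - 1) ^ 2))) := by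
  have ha0 : 0 < a := by linarith
  have hb0 : 0 < 2 * a - 1 := by linarith
  refine chiBound_gaussianReal_of_pdf (m' := 0) (w := ((2 * a - 1)⁻¹).toNNReal)
    (by simpa using ha0) (by simpa using hb0) (Real.exp_nonneg _) fun x => ?_
  simp only [gaussianPDFReal, Real.coe_toNNReal _ (inv_pos.2 ha0).le,
    Real.coe_toNNReal _ (inv_pos.2 hb0).le, NNReal.coe_one, mul_one, sub_zero]
  have hπ : 0 < 2 * Real.pi := by positivity
  rw [Real.sqrt_mul hπ.le, Real.sqrt_mul hπ.le, Real.sqrt_inv, Real.sqrt_inv]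
  have h1 : Real.exp (-x ^ 2 / (2 * a⁻¹)) ^ 2 =
      Real.exp (-x ^ 2 / 2) * Real.exp (-x ^ 2 / (2 * (2 * a - 1)⁻¹)) := by
    rw [← Real.exp_nat_mul, ← Real.exp_add]
    congr 1
    field_simp
    push_cast
    ring
  rw [mul_pow, h1, inv_pow, mul_pow, inv_pow, Real.sq_sqrt ha0.le, mul_inv, mul_inv, inv_inv,
    inv_inv]
  calc _ = a * (((√(2 * Real.pi)) ^ 2)⁻¹ *
        (Real.exp (-x ^ 2 / 2) * Real.exp (-x ^ 2 / (2 * (2 * a - 1)⁻¹)))) := by ring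
    _ ≤ (Real.exp ((a - 1) ^ 2) * √(2 * a - 1)) * (((√(2 * Real.pi)) ^ 2)⁻¹ *
        (Real.exp (-x ^ 2 / 2) * Real.exp (-x ^ 2 / (2 * (2 * a - 1)⁻¹)))) := by
        gcongr
        exact sqrt_ratio_bound ha
    _ = _ := by ring

/-! ### Multivariate Gaussian χ² bounds -/

section multivariate

open Matrix WithLp
open scoped RealInnerProductSpace

variable {ι : Type*} [Fintype ι] [DecidableEq ι]

lemma posSemidef_conj_diagonal (U : Matrix ι ι ℝ) (d : ι → NNReal) :
    (U * diagonal (fun i => (d i : ℝ)) * Uᵀ).PosSemidef := by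
  have h : (diagonal fun i => (d i : ℝ)).PosSemidef :=
    PosSemidef.diagonal fun i => NNReal.coe_nonneg _
  simpa using h.mul_mul_conjTranspose_same U

/-- Affine images of independent Gaussian variables. -/
lemma map_pi_gaussianReal (m : EuclideanSpace ℝ ι) (U : Matrix ι ι ℝ) (c : EuclideanSpace ℝ ι)
    (d : ι → NNReal) :
    (Measure.pi fun i => gaussianReal (c i) (d i)).map
        (fun x => m + toEuclideanCLM (𝕜 := ℝ) U (toLp 2 x)) =
      multivariateGaussian (m + toEuclideanCLM (𝕜 := ℝ) U c)
        (U * diagonal (fun i => (d i : ℝ)) * Uᵀ) := by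
  have hm1 : Measurable fun x : ι → ℝ => m + toEuclideanCLM (𝕜 := ℝ) U (toLp 2 x) := by fun_prop
  have := Measure.isProbabilityMeasure_map (μ := Measure.pi fun i => gaussianReal (c i) (d i))
    hm1.aemeasurable
  apply Measure.ext_of_charFun
  ext t
  rw [charFun_multivariateGaussian (posSemidef_conj_diagonal U d), charFun_apply,
    integral_map hm1.aemeasurable (by fun_prop)]
  set s : EuclideanSpace ℝ ι := toLp 2 (Uᵀ *ᵥ ofLp t) with hs
  have hin : ∀ y : EuclideanSpace ℝ ι, ⟪toEuclideanCLM (𝕜 := ℝ) U y, t⟫ = ⟪y, s⟫ := by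
    intro y
    rw [real_inner_comm, inner_toEuclideanCLM, EuclideanSpace.inner_eq_star_dotProduct, hs,
      Matrix.dotProduct_mulVec, ← Matrix.mulVec_transpose]
    rfl
  have h1 : ∀ x : ι → ℝ,
      Complex.exp (⟪m + toEuclideanCLM (𝕜 := ℝ) U (toLp 2 x), t⟫ * Complex.I) =
      Complex.exp (⟪t, m⟫ * Complex.I) * Complex.exp (⟪toLp 2 x, s⟫ * Complex.I) := by
    intro x
    rw [inner_add_left, hin, ← Complex.exp_add, real_inner_comm m t]
    push_cast
    ring_nf
  have h2 : ∫ x : ι → ℝ, Complex.exp (⟪toLp 2 x, s⟫ * Complex.I)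
      ∂(Measure.pi fun i => gaussianReal (c i) (d i)) =
      ∏ i, charFun (gaussianReal (c i) (d i)) (s i) := by
    rw [← charFun_pi, charFun_apply, integral_map (by fun_prop) (by fun_prop)]
  simp only [h1]
  rw [integral_const_mul, h2]
  simp only [charFun_gaussianReal]
  rw [← Complex.exp_sum, ← Complex.exp_add]
  congr 1
  have h3 : ⟪t, toEuclideanCLM (𝕜 := ℝ) U c⟫ = ∑ i, s i * c i := by
    rw [real_inner_comm, hin]
    simp [PiLp.inner_apply]
  have h4 : ofLp t ⬝ᵥ (U * diagonal (fun i => (d i : ℝ)) * Uᵀ) *ᵥ ofLp t =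
      ∑ i, d i * s i ^ 2 := by
    rw [← Matrix.mulVec_mulVec, ← Matrix.mulVec_mulVec, Matrix.dotProduct_mulVec,
      ← Matrix.mulVec_transpose]
    simp only [dotProduct, mulVec_diagonal, hs]
    exact Finset.sum_congr rfl fun i _ => by ring
  rw [inner_add_right, h3, h4]
  push_cast
  rw [Finset.sum_sub_distrib, add_mul, Finset.sum_mul, Finset.sum_div]
  ring

/-- Both laws are images of product Gaussians under the same affine map, so the bounds tensorise
over coordinates and are then pushed forward. Orthogonality of U makes the reference covariance the
identity. -/
lemma chiBound_multivariateGaussian {m c : EuclideanSpace ℝ ι} {U : Matrix ι ι ℝ}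
    (hU : U * Uᵀ = 1) {d : ι → NNReal} {b : ι → ℝ}
    (h : ∀ i, ChiBound (gaussianReal (c i) (d i)) (gaussianReal 0 1)
      (ENNReal.ofReal (Real.exp (b i)))) :
    ChiBound (multivariateGaussian (m + toEuclideanCLM (𝕜 := ℝ) U c)
        (U * diagonal (fun i => (d i : ℝ)) * Uᵀ))
      (multivariateGaussian m 1) (ENNReal.ofReal (Real.exp (∑ i, b i))) := by
  have h1 := map_pi_gaussianReal m U 0 (fun _ => 1)
  have h2 : (diagonal fun _ : ι => ((1 : NNReal) : ℝ)) = 1 := by simp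
  rw [h2, mul_one, hU, map_zero, add_zero] at h1
  rw [← map_pi_gaussianReal, ← h1, Real.exp_sum,
    ENNReal.ofReal_prod_of_nonneg fun i _ => Real.exp_nonneg _]
  exact (ChiBound.pi h).map (by fun_prop)

lemma chiBound_multivariateGaussian_mean (m δ : EuclideanSpace ℝ ι) :
    ChiBound (multivariateGaussian (m + δ) 1) (multivariateGaussian m 1)
      (ENNReal.ofReal (Real.exp (‖δ‖ ^ 2))) := by
  have := chiBound_multivariateGaussian (m := m) (c := δ) (U := 1) (by simp) (d := fun _ => 1)
    (fun i => chiBound_gaussianReal_mean (δ i))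
  simpa [EuclideanSpace.real_norm_sq_eq] using this

/-- Gaussian measures with a common mean, in terms of the spectrum of the precision matrix. -/
lemma chiBound_multivariateGaussian_inv (m : EuclideanSpace ℝ ι) {A : Matrix ι ι ℝ}
    (hA : A.IsHermitian) (ha : ∀ i, 3 / 4 ≤ hA.eigenvalues i) :
    ChiBound (multivariateGaussian m A⁻¹) (multivariateGaussian m 1)
      (ENNReal.ofReal (Real.exp (∑ i, (hA.eigenvalues i - 1) ^ 2))) := by
  set U : Matrix ι ι ℝ := (hA.eigenvectorUnitary : Matrix ι ι ℝ)
  have hstar : star U = Uᵀ := by simp [star_eq_conjTranspose]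
  have hU : U * Uᵀ = 1 := by rw [← hstar]; exact Unitary.coe_mul_star_self _
  have hU' : Uᵀ * U = 1 := by rw [← hstar]; exact Unitary.coe_star_mul_self _
  have hspec : A = U * diagonal hA.eigenvalues * Uᵀ := by
    conv_lhs => rw [hA.spectral_theorem, Unitary.conjStarAlgAut_apply]
    rw [← hstar]
    rfl
  have hpos : ∀ i, 0 < hA.eigenvalues i := fun i => by linarith [ha i]
  have hinv : A⁻¹ = U * diagonal (fun i => (((hA.eigenvalues i)⁻¹).toNNReal : ℝ)) * Uᵀ := by
    refine inv_eq_right_inv ?_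
    conv_lhs => arg 1; rw [hspec]
    have h1 : diagonal hA.eigenvalues *
        diagonal (fun i => (((hA.eigenvalues i)⁻¹).toNNReal : ℝ)) = 1 := by
      rw [diagonal_mul_diagonal, ← diagonal_one]
      congr 1
      ext i
      rw [Real.coe_toNNReal _ (inv_pos.2 (hpos i)).le, mul_inv_cancel₀ (hpos i).ne']
    calc _ = U * diagonal hA.eigenvalues * (Uᵀ * U) *
          diagonal (fun i => (((hA.eigenvalues i)⁻¹).toNNReal : ℝ)) * Uᵀ := by
            simp only [Matrix.mul_assoc]
      _ = U * (diagonal hA.eigenvalues *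
          diagonal (fun i => (((hA.eigenvalues i)⁻¹).toNNReal : ℝ))) * Uᵀ := by
            rw [hU', mul_one]; simp only [Matrix.mul_assoc]
      _ = 1 := by rw [h1, mul_one, hU]
  have := chiBound_multivariateGaussian (m := m) (c := 0) hU
    (fun i => chiBound_gaussianReal_var (ha i))
  rw [hinv]
  simpa using this

end multivariate

/-! ### Packing the unit ball -/

open Metric in
/-- The unit ball of `ℝᵖ` contains `2 ^ p` points at distance at least `1 / 4` from one another and
from the origin. -/
lemma exists_packing {p : ℕ} (hp : 0 < p) : ∃ V : Finset (EuclideanSpace ℝ (Fin p)),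
    V.card = 2 ^ p ∧ 0 ∉ V ∧ (∀ v ∈ V, ‖v‖ ≤ 1) ∧
    ∀ v ∈ insert 0 V, ∀ v' ∈ insert 0 V, v ≠ v' → 1 / 4 ≤ ‖v - v'‖ := by
  suffices H : ∀ N ≤ 2 ^ p, ∃ V : Finset (EuclideanSpace ℝ (Fin p)),
      V.card = N ∧ 0 ∉ V ∧ (∀ v ∈ V, ‖v‖ ≤ 1) ∧
      ∀ v ∈ insert 0 V, ∀ v' ∈ insert 0 V, v ≠ v' → 1 / 4 ≤ ‖v - v'‖ from H _ le_rfl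
  intro N
  induction N with
  | zero => exact fun _ => ⟨∅, by simp, by simp, by simp, by simp⟩
  | succ N ih =>
    intro hN
    obtain ⟨V, hc, h0, hn, hs⟩ := ih (by omega)
    -- At most 2^p balls of radius 1/4 have total volume at most 2^(−p) times that of the unit ball,
    -- so as long as they do not exceed that number a point remains uncovered.
    have : ∃ x ∈ ball (0 : EuclideanSpace ℝ (Fin p)) 1, x ∉ ⋃ v ∈ insert 0 V, ball v (1 / 4) := by
      by_contra! hcon
      have hle : volume (ball (0 : EuclideanSpace ℝ (Fin p)) 1) ≤
          (2 ^ p : ℕ) * (ENNReal.ofReal ((1 / 4) ^ p) *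
            volume (ball (0 : EuclideanSpace ℝ (Fin p)) 1)) := by
        calc _ ≤ volume (⋃ v ∈ insert 0 V, ball v (1 / 4)) := measure_mono hcon
          _ ≤ ∑ v ∈ insert 0 V, volume (ball v (1 / 4)) := measure_biUnion_finset_le _ _
          _ = ((insert 0 V).card : ℝ≥0∞) * (ENNReal.ofReal ((1 / 4) ^ p) *
            volume (ball (0 : EuclideanSpace ℝ (Fin p)) 1)) := by
              rw [← nsmul_eq_mul, ← Finset.sum_const]
              refine Finset.sum_congr rfl fun v _ => ?_
              rw [Measure.addHaar_ball_of_pos _ _ (by norm_num)]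
              simp
          _ ≤ _ := by
              gcongr
              exact (Finset.card_insert_le _ _).trans (by omega)
      have hpos : volume (ball (0 : EuclideanSpace ℝ (Fin p)) 1) ≠ 0 :=
        (measure_ball_pos _ _ one_pos).ne'
      have hfin : volume (ball (0 : EuclideanSpace ℝ (Fin p)) 1) ≠ ∞ := measure_ball_lt_top.ne
      rw [← mul_assoc] at hle
      have h1 : 1 * volume (ball (0 : EuclideanSpace ℝ (Fin p)) 1) ≤
          (2 ^ p : ℕ) * ENNReal.ofReal ((1 / 4) ^ p) *
            volume (ball (0 : EuclideanSpace ℝ (Fin p)) 1) := by rwa [one_mul]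
      rw [ENNReal.mul_le_mul_iff_left hpos hfin] at h1
      rw [← ENNReal.ofReal_natCast, ← ENNReal.ofReal_mul (by positivity),
        ENNReal.one_le_ofReal] at h1
      push_cast at h1
      rw [← mul_pow] at h1
      have : ((2 : ℝ) * (1 / 4)) ^ p < 1 := pow_lt_one₀ (by norm_num) (by norm_num) hp.ne'
      linarith
    obtain ⟨x, hx, hxV⟩ := this
    simp only [Set.mem_iUnion, not_exists, mem_ball, not_lt, dist_eq_norm] at hxV
    have hx0 : 0 ≠ x := fun h => by
      have := hxV 0 (Finset.mem_insert_self _ _)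
      rw [← h] at this
      norm_num at this
    have hxV' : x ∉ V := fun h => by
      have := hxV x (Finset.mem_insert_of_mem h)
      norm_num at this
    refine ⟨insert x V, by rw [Finset.card_insert_of_notMem hxV', hc],
      by simp [hx0, h0], ?_, ?_⟩
    · intro v hv
      rcases Finset.mem_insert.1 hv with rfl | hv
      · exact (mem_ball_zero_iff.1 hx).le
      · exact hn v hv
    · rw [Finset.insert_comm]
      intro v hv v' hv' hne
      rcases Finset.mem_insert.1 hv with rfl | hvV
      · rcases Finset.mem_insert.1 hv' with rfl | hv'
        · exact absurd rfl hne
        · exact hxV v' hv'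
      · rcases Finset.mem_insert.1 hv' with rfl | hv'
        · rw [norm_sub_rev]
          exact hxV v hvV
        · exact hs v hvV v' hv' hne

/-! ### Low-rank perturbations of the precision matrix -/

section precision

open Matrix WithLp
open scoped RealInnerProductSpace

variable {p : ℕ}

/-- The precision matrix `1 + ρ (v eᵀ + e vᵀ)`. -/
noncomputable def precMat (e : EuclideanSpace ℝ (Fin p)) (ρ : ℝ) (v : EuclideanSpace ℝ (Fin p)) :
    Matrix (Fin p) (Fin p) ℝ :=
  1 + ρ • (vecMulVec v e + vecMulVec e v)

@[simp] lemma precMat_zero (e : EuclideanSpace ℝ (Fin p)) (ρ : ℝ) : precMat e ρ 0 = 1 := by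
  simp [precMat]

lemma toEuclideanCLM_precMat (e v x : EuclideanSpace ℝ (Fin p)) (ρ : ℝ) :
    toEuclideanCLM (𝕜 := ℝ) (precMat e ρ v) x = x + ρ • (⟪e, x⟫ • v + ⟪v, x⟫ • e) := by
  ext i
  simp [precMat, vecMulVec_mulVec, PiLp.inner_apply,
    dotProduct, mul_comm]

lemma isHermitian_precMat (e v : EuclideanSpace ℝ (Fin p)) (ρ : ℝ) :
    (precMat e ρ v).IsHermitian := by
  ext i j
  simp [precMat, vecMulVec_apply, Matrix.one_apply, eq_comm (a := i) (b := j)]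
  ring

lemma norm_toEuclideanCLM_precMat_sub_le {e v : EuclideanSpace ℝ (Fin p)} {ρ : ℝ} (hρ : 0 ≤ ρ)
    (he : ‖e‖ = 1) (hv : ‖v‖ ≤ 1) (x : EuclideanSpace ℝ (Fin p)) :
    ‖toEuclideanCLM (𝕜 := ℝ) (precMat e ρ v) x - x‖ ≤ 2 * ρ * ‖x‖ := by
  rw [toEuclideanCLM_precMat, add_sub_cancel_left, norm_smul, Real.norm_of_nonneg hρ]
  have h1 : ‖⟪e, x⟫ • v‖ ≤ ‖x‖ := by
    rw [norm_smul]
    have := abs_real_inner_le_norm e x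
    rw [he, one_mul] at this
    exact (mul_le_mul this hv (norm_nonneg _) (norm_nonneg _)).trans_eq (mul_one _)
  have h2 : ‖⟪v, x⟫ • e‖ ≤ ‖x‖ := by
    rw [norm_smul, he, mul_one]
    exact (abs_real_inner_le_norm v x).trans (mul_le_of_le_one_left (norm_nonneg _) hv)
  calc _ ≤ ρ * (‖⟪e, x⟫ • v‖ + ‖⟪v, x⟫ • e‖) := by gcongr; exact norm_add_le _ _
    _ ≤ ρ * (‖x‖ + ‖x‖) := by gcongr
    _ = _ := by ring

lemma toEuclideanCLM_eigenvectorBasis {A : Matrix (Fin p) (Fin p) ℝ} (hA : A.IsHermitian)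
    (i : Fin p) : toEuclideanCLM (𝕜 := ℝ) A (hA.eigenvectorBasis i) =
      hA.eigenvalues i • hA.eigenvectorBasis i := by
  have := hA.mulVec_eigenvectorBasis i
  ext j
  simpa using congrFun this j

lemma abs_eigenvalues_sub_one {A : Matrix (Fin p) (Fin p) ℝ} (hA : A.IsHermitian) (i : Fin p) :
    |hA.eigenvalues i - 1| =
      ‖toEuclideanCLM (𝕜 := ℝ) A (hA.eigenvectorBasis i) - hA.eigenvectorBasis i‖ := by
  have h := sub_smul (hA.eigenvalues i) 1 (hA.eigenvectorBasis i)
  rw [one_smul] at h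
  rw [toEuclideanCLM_eigenvectorBasis, ← h, norm_smul,
    hA.eigenvectorBasis.norm_eq_one, mul_one, Real.norm_eq_abs]

lemma eigenvalues_precMat {e v : EuclideanSpace ℝ (Fin p)} {ρ : ℝ} (hρ : 0 ≤ ρ) (hρ' : ρ ≤ 1 / 8)
    (he : ‖e‖ = 1) (hv : ‖v‖ ≤ 1) (i : Fin p) :
    3 / 4 ≤ (isHermitian_precMat e v ρ).eigenvalues i := by
  have h1 := abs_eigenvalues_sub_one (isHermitian_precMat e v ρ) i
  have h2 := norm_toEuclideanCLM_precMat_sub_le hρ he hv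
    ((isHermitian_precMat e v ρ).eigenvectorBasis i)
  rw [OrthonormalBasis.norm_eq_one, ← h1] at h2
  have := (abs_le.1 h2).1
  linarith

/-- By Parseval in the eigenbasis the squared Frobenius norm of the perturbation is controlled by
‖e‖ and ‖v‖ alone, so the χ² cost is free of the dimension. -/
lemma sum_sq_eigenvalues_precMat {e v : EuclideanSpace ℝ (Fin p)} (ρ : ℝ)
    (he : ‖e‖ = 1) (hv : ‖v‖ ≤ 1) :
    ∑ i, ((isHermitian_precMat e v ρ).eigenvalues i - 1) ^ 2 ≤ 4 * ρ ^ 2 := by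
  set b := (isHermitian_precMat e v ρ).eigenvectorBasis
  have key : ∀ i, ((isHermitian_precMat e v ρ).eigenvalues i - 1) ^ 2 ≤
      2 * ρ ^ 2 * (⟪e, b i⟫ ^ 2 + ⟪v, b i⟫ ^ 2) := by
    intro i
    rw [← sq_abs, abs_eigenvalues_sub_one, toEuclideanCLM_precMat, add_sub_cancel_left,
      norm_smul, mul_pow, Real.norm_eq_abs, sq_abs]
    have h1 : ‖⟪e, b i⟫ • v + ⟪v, b i⟫ • e‖ ≤ |⟪e, b i⟫| + |⟪v, b i⟫| := by
      refine (norm_add_le _ _).trans ?_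
      rw [norm_smul, norm_smul, he, mul_one, Real.norm_eq_abs, Real.norm_eq_abs]
      gcongr
      exact mul_le_of_le_one_right (abs_nonneg _) hv
    calc _ ≤ ρ ^ 2 * (|⟪e, b i⟫| + |⟪v, b i⟫|) ^ 2 := by gcongr
      _ ≤ ρ ^ 2 * (2 * (|⟪e, b i⟫| ^ 2 + |⟪v, b i⟫| ^ 2)) := by
          gcongr; exact add_sq_le
      _ = _ := by rw [sq_abs, sq_abs]; ring
  calc _ ≤ ∑ i, 2 * ρ ^ 2 * (⟪e, b i⟫ ^ 2 + ⟪v, b i⟫ ^ 2) := Finset.sum_le_sum fun i _ => key i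
    _ = 2 * ρ ^ 2 * (‖e‖ ^ 2 + ‖v‖ ^ 2) := by
        rw [← Finset.mul_sum, Finset.sum_add_distrib, b.sum_sq_inner_left, b.sum_sq_inner_left]
    _ ≤ 2 * ρ ^ 2 * (1 + 1) := by
        gcongr
        · rw [he, one_pow]
        · exact pow_le_one₀ (norm_nonneg _) hv
    _ = _ := by ring

lemma isUnit_det_precMat {e v : EuclideanSpace ℝ (Fin p)} {ρ : ℝ} (hρ : 0 ≤ ρ) (hρ' : ρ ≤ 1 / 8)
    (he : ‖e‖ = 1) (hv : ‖v‖ ≤ 1) : IsUnit (precMat e ρ v).det := by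
  rw [isUnit_iff_ne_zero, (isHermitian_precMat e v ρ).det_eq_prod_eigenvalues,
    Finset.prod_ne_zero_iff]
  intro i _
  have := eigenvalues_precMat hρ hρ' he hv i
  simp only [RCLike.ofReal_real_eq_id, id_eq]
  linarith

/-- A unit eigenvector x with eigenvalue l of the inverse satisfies x = l A x; as A moves x by at
most 2ρ, this gives |1 − l| ≤ 2ρ|l|. -/
lemma eigenvalues_inv_precMat {e v : EuclideanSpace ℝ (Fin p)} {ρ cS : ℝ} (hρ : 0 ≤ ρ)
    (hρ' : ρ ≤ 1 / 8) (hcS : 1 < cS) (hρS : 2 * ρ ≤ 1 - cS⁻¹) (he : ‖e‖ = 1) (hv : ‖v‖ ≤ 1)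
    (h : (precMat e ρ v)⁻¹.IsHermitian) (i : Fin p) :
    cS⁻¹ ≤ h.eigenvalues i ∧ h.eigenvalues i ≤ cS := by
  set l := h.eigenvalues i
  set x := h.eigenvectorBasis i
  have hx : ‖x‖ = 1 := h.eigenvectorBasis.norm_eq_one i
  have h1 : x = l • toEuclideanCLM (𝕜 := ℝ) (precMat e ρ v) x := by
    rw [← map_smul, ← toEuclideanCLM_eigenvectorBasis h i, ← mul_apply_eq_comp,
      ← map_mul, mul_nonsing_inv _ (isUnit_det_precMat hρ hρ' he hv), map_one]
    rfl
  have h2 := norm_toEuclideanCLM_precMat_sub_le hρ he hv x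
  have h3 : |1 - l| ≤ |l| * (2 * ρ) := by
    have h4 : (1 - l) • x = l • (toEuclideanCLM (𝕜 := ℝ) (precMat e ρ v) x - x) := by
      rw [smul_sub, ← h1, sub_smul, one_smul]
    have h5 := congrArg norm h4
    rw [norm_smul, norm_smul, hx, mul_one, Real.norm_eq_abs, Real.norm_eq_abs] at h5
    rw [h5]
    gcongr
    simpa [hx] using h2
  have hc0 : 0 < cS⁻¹ := by positivity
  have hc1 : cS⁻¹ * cS = 1 := inv_mul_cancel₀ (by positivity)
  have hl : 0 ≤ l := by
    by_contra! hneg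
    rw [abs_of_neg hneg] at h3
    have := le_abs_self (1 - l)
    nlinarith
  rw [abs_of_nonneg hl, abs_le] at h3
  constructor
  · have h6 : cS⁻¹ * (1 + 2 * ρ) ≤ 1 := by nlinarith
    nlinarith
  · have h7 : l * cS⁻¹ ≤ 1 := by nlinarith
    have : l * cS⁻¹ * cS = l := by rw [mul_assoc, hc1, mul_one]
    nlinarith

/-- The difference is ρ(1 + e eᵀ)(v − v'), and 1 + e eᵀ does not shrink norms. Hence β, proportional
to the image of e, inherits the separation of the packing. -/
lemma norm_precMat_apply_sub {e v v' : EuclideanSpace ℝ (Fin p)} {ρ : ℝ} (hρ : 0 ≤ ρ)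
    (he : ‖e‖ = 1) :
    ρ * ‖v - v'‖ ≤ ‖toEuclideanCLM (𝕜 := ℝ) (precMat e ρ v) e -
      toEuclideanCLM (𝕜 := ℝ) (precMat e ρ v') e‖ := by
  have h1 : toEuclideanCLM (𝕜 := ℝ) (precMat e ρ v) e -
      toEuclideanCLM (𝕜 := ℝ) (precMat e ρ v') e =
      ρ • ((v - v') + ⟪v - v', e⟫ • e) := by
    rw [toEuclideanCLM_precMat, toEuclideanCLM_precMat, real_inner_self_eq_norm_sq, he,
      inner_sub_left]
    module
  rw [h1, norm_smul, Real.norm_of_nonneg hρ]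
  gcongr
  refine le_of_sq_le_sq ?_ (norm_nonneg _)
  rw [norm_add_sq_real, inner_smul_right, norm_smul, he, mul_one, Real.norm_eq_abs, sq_abs]
  nlinarith [sq_nonneg ⟪v - v', e⟫]

lemma norm_toEuclideanCLM_precMat_le {e v : EuclideanSpace ℝ (Fin p)} {ρ : ℝ} (hρ : 0 ≤ ρ)
    (hρ' : ρ ≤ 1 / 8) (he : ‖e‖ = 1) (hv : ‖v‖ ≤ 1) :
    ‖toEuclideanCLM (n := Fin p) (𝕜 := ℝ) (precMat e ρ v)‖ ≤ 2 := by
  refine ContinuousLinearMap.opNorm_le_bound _ (by norm_num) fun x => ?_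
  have h1 := norm_toEuclideanCLM_precMat_sub_le hρ he hv x
  have h2 := norm_add_le (toEuclideanCLM (𝕜 := ℝ) (precMat e ρ v) x - x) x
  rw [sub_add_cancel] at h2
  nlinarith [norm_nonneg x]

/-- Separation passes from precisions to covariances through A' − A = A(A⁻¹ − A'⁻¹)A', the two outer
factors having norm at most 2. -/
lemma specNorm_inv_precMat_sub {e v v' : EuclideanSpace ℝ (Fin p)} {ρ : ℝ} (hρ : 0 ≤ ρ)
    (hρ' : ρ ≤ 1 / 8) (he : ‖e‖ = 1) (hv : ‖v‖ ≤ 1) (hv' : ‖v'‖ ≤ 1) :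
    ρ * ‖v - v'‖ ≤ 4 * specNorm ((precMat e ρ v)⁻¹ - (precMat e ρ v')⁻¹) := by
  have h1 : precMat e ρ v' - precMat e ρ v =
      precMat e ρ v * ((precMat e ρ v)⁻¹ - (precMat e ρ v')⁻¹) * precMat e ρ v' := by
    rw [mul_sub, sub_mul, mul_nonsing_inv _ (isUnit_det_precMat hρ hρ' he hv), one_mul, mul_assoc,
      nonsing_inv_mul _ (isUnit_det_precMat hρ hρ' he hv'), mul_one]
  have h2 := norm_precMat_apply_sub (v := v') (v' := v) hρ he
  rw [← _root_.sub_apply, ← map_sub, h1, map_mul, map_mul, norm_sub_rev] at h2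
  set T := toEuclideanCLM (n := Fin p) (𝕜 := ℝ) (precMat e ρ v)
  set T' := toEuclideanCLM (n := Fin p) (𝕜 := ℝ) (precMat e ρ v')
  have hT : ‖T‖ ≤ 2 := norm_toEuclideanCLM_precMat_le hρ hρ' he hv
  have hT' : ‖T'‖ ≤ 2 := norm_toEuclideanCLM_precMat_le hρ hρ' he hv'
  unfold specNorm
  set D := toEuclideanCLM (n := Fin p) (𝕜 := ℝ) ((precMat e ρ v)⁻¹ - (precMat e ρ v')⁻¹)
  calc _ ≤ _ := h2
    _ ≤ ‖T * D * T'‖ * ‖e‖ := ContinuousLinearMap.le_opNorm _ _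
    _ = ‖T * D * T'‖ := by rw [he, mul_one]
    _ ≤ ‖T‖ * ‖D‖ * ‖T'‖ := by
        refine (norm_mul_le _ _).trans ?_
        gcongr
        exact norm_mul_le _ _
    _ ≤ 2 * ‖D‖ * 2 := by gcongr
    _ = _ := by ring

end precision

/-! ### Membership in the parameter spaces -/

lemma radius_le {ι E : Type*} [NormedAddCommGroup E] {x : ι → E} {h : ℝ} (v : E) (hh : 0 ≤ h)
    (hx : ∀ i, ‖x i - v‖ ≤ h) : radius x ≤ h := by
  -- Nonnegativity of h covers an empty index type, where the real supremum is 0.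
  refine (ciInf_le ⟨0, ?_⟩ v).trans (Real.iSup_le hx hh)
  rintro _ ⟨w, rfl⟩
  exact Real.iSup_nonneg fun i => norm_nonneg _

/-- A single parameter θ₀ serves as the centre for all four radii. -/
lemma mem_jointSpace {p K : ℕ} {M cw cS hw hμ hβ : ℝ} {S : Finset (Fin K)}
    {θ : {k // k ∈ S} → GMMParam p} (θ₀ : GMMParam p) (hw0 : 0 ≤ hw) (hμ0 : 0 ≤ hμ) (hβ0 : 0 ≤ hβ)
    (h : ∀ k, θ k ∈ singleSpace p M cw cS) (h1 : ∀ k, |(θ k).w - θ₀.w| ≤ hw)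
    (h2 : ∀ k, ‖(θ k).μ₁ - θ₀.μ₁‖ ≤ hμ) (h3 : ∀ k, ‖(θ k).μ₂ - θ₀.μ₂‖ ≤ hμ)
    (h4 : ∀ k, ‖(θ k).beta - θ₀.beta‖ ≤ hβ) : θ ∈ jointSpace M cw cS S hw hμ hβ :=
  ⟨h, radius_le _ hw0 h1, max_le (radius_le _ hμ0 h2) (radius_le _ hμ0 h3), radius_le _ hβ0 h4⟩

lemma const_mem_jointSpace {p K : ℕ} {M cw cS hw hμ hβ : ℝ} {S : Finset (Fin K)}
    {θ : GMMParam p} (hw0 : 0 ≤ hw) (hμ0 : 0 ≤ hμ) (hβ0 : 0 ≤ hβ)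
    (h : θ ∈ singleSpace p M cw cS) :
    (fun _ : {k // k ∈ S} => θ) ∈ jointSpace M cw cS S hw hμ hβ :=
  mem_jointSpace θ hw0 hμ0 hβ0 (fun _ => h) (fun _ => by simpa) (fun _ => by simpa)
    (fun _ => by simpa) (fun _ => by simpa)

lemma isProbabilityMeasure_law {p : ℕ} {θ : GMMParam p} (h0 : 0 ≤ θ.w) (h1 : θ.w ≤ 1) :
    IsProbabilityMeasure θ.law := by
  constructor
  rw [GMMParam.law, Measure.add_apply, Measure.smul_apply, Measure.smul_apply, measure_univ,
    measure_univ, smul_eq_mul, smul_eq_mul, mul_one, mul_one, ← ENNReal.ofReal_add (by linarith) h0,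
    sub_add_cancel, ENNReal.ofReal_one]

lemma isProbabilityMeasure_law_of_mem {p : ℕ} {M cw cS : ℝ} (hcw : 0 < cw) {θ : GMMParam p}
    (h : θ ∈ singleSpace p M cw cS) : IsProbabilityMeasure θ.law :=
  isProbabilityMeasure_law (hcw.le.trans h.2.1.1.le) (by linarith [h.2.1.2])

lemma chiBound_law_of_mixture {p : ℕ} {θ θ' : GMMParam p} {B : ℝ≥0∞} (h0 : 0 ≤ θ.w) (h1 : θ.w ≤ 1)
    (hw : θ.w = θ'.w)
    (h₁ : ChiBound (multivariateGaussian θ.μ₁ θ.cov) (multivariateGaussian θ'.μ₁ θ'.cov) B)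
    (h₂ : ChiBound (multivariateGaussian θ.μ₂ θ.cov) (multivariateGaussian θ'.μ₂ θ'.cov) B) :
    ChiBound θ.law θ'.law B := by
  unfold GMMParam.law
  rw [← hw]
  refine h₁.smul_add_smul h₂ ?_
  rw [← ENNReal.ofReal_add (by linarith) h0, sub_add_cancel, ENNReal.ofReal_one]

/-! ### The three parametric families and their separation -/

section families

variable {p : ℕ}

/-- Mixtures with separated components, indexed by the deviation of the mixture proportion. -/
noncomputable def wFam (m : ℝ) (e : EuclideanSpace ℝ (Fin p)) (r v : ℝ) : GMMParam p :=
  ⟨1 / 2 + r * v, m • e, -(m • e), 1⟩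

/-- Mixtures with separated components, indexed by a common deviation of both means. -/
noncomputable def meanFam (m : ℝ) (e : EuclideanSpace ℝ (Fin p)) (r : ℝ)
    (v : EuclideanSpace ℝ (Fin p)) : GMMParam p :=
  ⟨1 / 2, m • e + r • v, -(m • e) + r • v, 1⟩

/-- Mixtures indexed by the deviation of the precision matrix. -/
noncomputable def covFam (m : ℝ) (e : EuclideanSpace ℝ (Fin p)) (ρ : ℝ)
    (v : EuclideanSpace ℝ (Fin p)) : GMMParam p :=
  ⟨1 / 2, m • e, -(m • e), (precMat e ρ v)⁻¹⟩

lemma exists_isHermitian_one {cS : ℝ} (hcS : 1 < cS) :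
    ∃ hS : (1 : Matrix (Fin p) (Fin p) ℝ).IsHermitian,
      ∀ i, cS⁻¹ ≤ hS.eigenvalues i ∧ hS.eigenvalues i ≤ cS := by
  refine ⟨Matrix.isHermitian_one, fun i => ?_⟩
  have h : |(Matrix.isHermitian_one (n := Fin p) (α := ℝ)).eigenvalues i - 1| = 0 := by
    rw [abs_eigenvalues_sub_one, map_one]
    simp
  rw [abs_eq_zero, sub_eq_zero] at h
  rw [h]
  exact ⟨inv_le_one_of_one_le₀ hcS.le, hcS.le⟩

variable {M cw cS m r ρ : ℝ} {e v v' : EuclideanSpace ℝ (Fin p)}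

lemma wFam_mem (hm : 0 ≤ m) (hmM : m ≤ M) (hcS : 1 < cS) (he : ‖e‖ = 1) (hr : 0 ≤ r)
    (hr' : r < 1 / 2 - cw) {v : ℝ} (hv : |v| ≤ 1) : wFam m e r v ∈ singleSpace p M cw cS := by
  have hrv : |r * v| ≤ r := by
    rw [abs_mul, abs_of_nonneg hr]; exact mul_le_of_le_one_right hr hv
  rw [abs_le] at hrv
  refine ⟨?_, ⟨?_, ?_⟩, exists_isHermitian_one hcS⟩
  · simpa [wFam, norm_smul, he, abs_of_nonneg hm] using hmM
  · simp only [wFam]; linarith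
  · simp only [wFam]; linarith

lemma meanFam_mem (hm : 0 ≤ m) (hr : 0 ≤ r) (hmM : m + r ≤ M) (hcw : cw < 1 / 2) (hcS : 1 < cS)
    (he : ‖e‖ = 1) (hv : ‖v‖ ≤ 1) : meanFam m e r v ∈ singleSpace p M cw cS := by
  have h1 : ‖m • e‖ = m := by rw [norm_smul, he, mul_one, Real.norm_of_nonneg hm]
  have h2 : ‖r • v‖ ≤ r := by
    rw [norm_smul, Real.norm_of_nonneg hr]; exact mul_le_of_le_one_right hr hv
  refine ⟨max_le ?_ ?_, ⟨?_, ?_⟩, exists_isHermitian_one hcS⟩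
  · exact (norm_add_le _ _).trans (by linarith)
  · exact (norm_add_le _ _).trans (by rw [norm_neg]; linarith)
  · exact hcw
  · simp only [meanFam]; linarith

lemma covFam_mem (hm : 0 ≤ m) (hmM : m ≤ M) (hcw : cw < 1 / 2) (hcS : 1 < cS) (he : ‖e‖ = 1)
    (hv : ‖v‖ ≤ 1) (hρ : 0 ≤ ρ) (hρ' : ρ ≤ 1 / 8) (hρS : 2 * ρ ≤ 1 - cS⁻¹) :
    covFam m e ρ v ∈ singleSpace p M cw cS := by
  refine ⟨?_, ⟨hcw, ?_⟩, (isHermitian_precMat e v ρ).inv,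
    eigenvalues_inv_precMat hρ hρ' hcS hρS he hv _⟩
  · simpa [covFam, norm_smul, he, abs_of_nonneg hm] using hmM
  · simp only [covFam]; linarith

lemma wFam_beta {v : ℝ} : (wFam m e r v).beta = (2 * m) • e := by
  simp only [GMMParam.beta, wFam, inv_one]
  ext i
  simp [two_mul, add_mul]

lemma meanFam_beta : (meanFam m e r v).beta = (2 * m) • e := by
  simp only [GMMParam.beta, meanFam, inv_one]
  ext i
  simp [two_mul, add_mul]

lemma covFam_beta (he : ‖e‖ = 1) (hv : ‖v‖ ≤ 1) (hρ : 0 ≤ ρ) (hρ' : ρ ≤ 1 / 8) :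
    (covFam m e ρ v).beta = (2 * m) • Matrix.toEuclideanCLM (𝕜 := ℝ) (precMat e ρ v) e := by
  simp only [GMMParam.beta, covFam]
  rw [Matrix.nonsing_inv_nonsing_inv _ (isUnit_det_precMat hρ hρ' he hv), sub_neg_eq_add,
    ← two_smul ℝ, smul_smul, map_smul, ← Matrix.coe_toEuclideanCLM_eq_toEuclideanLin]
  rfl

/-- Only the weights change, so the cost is at most the χ² divergence 4t² between Bernoulli weights
1/2 ± t and the fair ones, wherever the components lie. -/
lemma wFam_chiBound (hr : 0 ≤ r) (hr' : r ≤ 1 / 2) {v : ℝ} (hv : |v| ≤ 1) :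
    ChiBound (wFam m e r v).law (wFam m e r 0).law (ENNReal.ofReal (Real.exp (4 * r ^ 2))) := by
  have hrv : |r * v| ≤ r := by
    rw [abs_mul, abs_of_nonneg hr]; exact mul_le_of_le_one_right hr hv
  have hsq : (r * v) ^ 2 ≤ r ^ 2 := sq_le_sq' (by linarith [(abs_le.1 hrv).1]) (abs_le.1 hrv).2
  set t := r * v
  obtain ⟨ht1, ht2⟩ := abs_le.1 (hrv.trans hr')
  intro f hf
  have hc : ∀ P : Measure (EuclideanSpace ℝ (Fin p)), IsProbabilityMeasure P →
      (∫⁻ x, f x ∂P) ^ 2 ≤ ∫⁻ x, f x ^ 2 ∂P := fun P _ => by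
    simpa using ChiBound.refl P f hf
  simp only [GMMParam.law, wFam, mul_zero, add_zero, lintegral_add_measure,
    lintegral_smul_measure, smul_eq_mul]
  have h1 := hc (multivariateGaussian (m • e) 1) inferInstance
  have h2 := hc (multivariateGaussian (-(m • e)) 1) inferInstance
  set a := ∫⁻ x, f x ∂multivariateGaussian (m • e) 1
  set b := ∫⁻ x, f x ∂multivariateGaussian (-(m • e)) 1
  set A := ∫⁻ x, f x ^ 2 ∂multivariateGaussian (m • e) 1
  set B := ∫⁻ x, f x ^ 2 ∂multivariateGaussian (-(m • e)) 1
  have hE : (1 : ℝ) ≤ Real.exp (4 * r ^ 2) := Real.one_le_exp (by positivity)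
  have hhalf : ENNReal.ofReal (1 - 1 / 2) = ENNReal.ofReal (1 / 2) := by norm_num
  rw [hhalf]
  suffices H : (ENNReal.ofReal (1 - (1 / 2 + t)) * a + ENNReal.ofReal (1 / 2 + t) * b) ^ 2 ≤
      ENNReal.ofReal (Real.exp (4 * r ^ 2)) *
        (ENNReal.ofReal (1 / 2) * a ^ 2 + ENNReal.ofReal (1 / 2) * b ^ 2) by
    refine H.trans ?_
    gcongr
  rcases eq_or_ne a ∞ with ha | ha
  · rw [ha]
    refine le_top.trans (le_of_eq ?_)
    symm
    simp [Real.exp_pos, ENNReal.mul_top]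
  rcases eq_or_ne b ∞ with hb | hb
  · rw [hb]
    refine le_top.trans (le_of_eq ?_)
    symm
    simp [Real.exp_pos, ENNReal.mul_top]
  rw [← ENNReal.ofReal_toReal ha, ← ENNReal.ofReal_toReal hb]
  set x := a.toReal
  set y := b.toReal
  have hx : 0 ≤ x := ENNReal.toReal_nonneg
  have hy : 0 ≤ y := ENNReal.toReal_nonneg
  have hs1 : 0 ≤ 1 - (1 / 2 + t) := by linarith
  have hs2 : 0 ≤ 1 / 2 + t := by linarith
  rw [← ENNReal.ofReal_mul hs1, ← ENNReal.ofReal_mul hs2, ← ENNReal.ofReal_add (by positivity)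
    (by positivity), ← ENNReal.ofReal_pow (by positivity), ← ENNReal.ofReal_pow hx,
    ← ENNReal.ofReal_pow hy, ← ENNReal.ofReal_mul (by norm_num), ← ENNReal.ofReal_mul (by norm_num),
    ← ENNReal.ofReal_add (by positivity) (by positivity), ← ENNReal.ofReal_mul (by positivity)]
  apply ENNReal.ofReal_le_ofReal
  calc ((1 - (1 / 2 + t)) * x + (1 / 2 + t) * y) ^ 2
      ≤ (1 + 4 * t ^ 2) * (1 / 2 * x ^ 2 + 1 / 2 * y ^ 2) := by
        nlinarith [sq_nonneg ((1 / 2 - t) * y - (1 / 2 + t) * x)]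
    _ ≤ _ := by
        gcongr
        calc 1 + 4 * t ^ 2 ≤ 4 * r ^ 2 + 1 := by linarith
          _ ≤ _ := Real.add_one_le_exp _

lemma meanFam_chiBound (hr : 0 ≤ r) (hv : ‖v‖ ≤ 1) :
    ChiBound (meanFam m e r v).law (meanFam m e r 0).law (ENNReal.ofReal (Real.exp (r ^ 2))) := by
  have hB : ENNReal.ofReal (Real.exp (‖r • v‖ ^ 2)) ≤ ENNReal.ofReal (Real.exp (r ^ 2)) := by
    gcongr
    rw [norm_smul, Real.norm_of_nonneg hr]
    exact mul_le_of_le_one_right hr hv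
  refine chiBound_law_of_mixture (by norm_num [meanFam]) (by norm_num [meanFam]) rfl ?_ ?_
  · simpa [meanFam] using (chiBound_multivariateGaussian_mean (m • e) (r • v)).mono hB
  · simpa [meanFam] using (chiBound_multivariateGaussian_mean (-(m • e)) (r • v)).mono hB

lemma covFam_chiBound (he : ‖e‖ = 1) (hv : ‖v‖ ≤ 1) (hρ : 0 ≤ ρ) (hρ' : ρ ≤ 1 / 8) :
    ChiBound (covFam m e ρ v).law (covFam m e ρ 0).law
      (ENNReal.ofReal (Real.exp (4 * ρ ^ 2))) := by
  have key : ∀ x, ChiBound (multivariateGaussian x (precMat e ρ v)⁻¹) (multivariateGaussian x 1)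
      (ENNReal.ofReal (Real.exp (4 * ρ ^ 2))) := fun x =>
    (chiBound_multivariateGaussian_inv x (isHermitian_precMat e v ρ)
      (eigenvalues_precMat hρ hρ' he hv)).mono (by
        gcongr
        exact sum_sq_eigenvalues_precMat ρ he hv)
  refine chiBound_law_of_mixture (by norm_num [covFam]) (by norm_num [covFam]) rfl ?_ ?_
  · simpa [covFam] using key (m • e)
  · simpa [covFam] using key (-(m • e))

lemma abs_w_sub_le_paramDist (θ θ' : GMMParam p) : |θ.w - θ'.w| ≤ paramDist θ.disc θ'.disc :=
  le_max_left _ _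

lemma norm_μ₁_sub_le_paramDist (θ θ' : GMMParam p) :
    ‖θ.μ₁ - θ'.μ₁‖ ≤ paramDist θ.disc θ'.disc :=
  (le_max_left _ _).trans (le_max_right _ _)

lemma norm_beta_sub_le_paramDist (θ θ' : GMMParam p) :
    ‖θ.beta - θ'.beta‖ ≤ paramDist θ.disc θ'.disc :=
  (le_max_right _ _).trans ((le_max_right _ _).trans (le_max_right _ _))

lemma paramDist_le (x a b : DiscParam p) : paramDist a b ≤ paramDist x a + paramDist x b := by
  have h : ∀ {E : Type} [NormedAddCommGroup E] (x a b : E), ‖a - b‖ ≤ ‖x - a‖ + ‖x - b‖ := by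
    intro E _ x a b
    rw [norm_sub_rev x a]
    exact norm_sub_le_norm_sub_add_norm_sub a x b
  unfold paramDist
  refine max_le ?_ (max_le ?_ (max_le ?_ ?_))
  · exact (h x.1 a.1 b.1).trans (add_le_add (le_max_left _ _) (le_max_left _ _))
  · refine (h x.2.1 a.2.1 b.2.1).trans (add_le_add ?_ ?_) <;> simp
  · refine (h x.2.2.1 a.2.2.1 b.2.2.1).trans (add_le_add ?_ ?_) <;> simp
  · refine (h x.2.2.2 a.2.2.2 b.2.2.2).trans (add_le_add ?_ ?_) <;> simp

lemma specNorm_sub_le (X A B : Matrix (Fin p) (Fin p) ℝ) :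
    specNorm (A - B) ≤ specNorm (X - A) + specNorm (X - B) := by
  unfold specNorm
  rw [map_sub, map_sub, map_sub, ← norm_neg (_ - Matrix.toEuclideanCLM (n := Fin p) (𝕜 := ℝ) A),
    neg_sub]
  exact norm_sub_le_norm_sub_add_norm_sub _ _ _

lemma measurable_paramDist {α : Type*} [MeasurableSpace α] {f : α → DiscParam p}
    (hf : Measurable f) (b : DiscParam p) : Measurable fun z => paramDist (f z) b := by
  have : Continuous fun a : DiscParam p => paramDist a b := by
    unfold paramDist
    fun_prop
  exact this.measurable.comp hf

lemma measurable_specNorm_sub {α : Type*} [MeasurableSpace α]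
    {f : α → Matrix (Fin p) (Fin p) ℝ} (hf : ∀ i j, Measurable fun z => f z i j)
    (B : Matrix (Fin p) (Fin p) ℝ) : Measurable fun z => specNorm (f z - B) := by
  have hlin : Continuous fun A : Fin p → Fin p → ℝ =>
      Matrix.toEuclideanCLM (n := Fin p) (𝕜 := ℝ) (Matrix.of A) :=
    LinearMap.continuous_of_finiteDimensional
      (((Matrix.toEuclideanCLM (n := Fin p) (𝕜 := ℝ)).toAlgEquiv.toLinearMap.comp
        (Matrix.ofLinearEquiv ℝ).toLinearMap))
  have : Continuous fun A : Fin p → Fin p → ℝ => specNorm (Matrix.of A - B) := by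
    unfold specNorm
    simp only [map_sub]
    exact (hlin.sub continuous_const).norm
  exact this.measurable.comp (measurable_pi_lambda _ fun i => measurable_pi_lambda _ fun j => hf i j)

end families

/-! ### Lower bounds for the law of the complete data -/

section dataLaw

variable {p K : ℕ} {n : Fin K → ℕ} {S : Finset (Fin K)}

lemma isProbabilityMeasure_dataLaw {θ : {k // k ∈ S} → GMMParam p}
    (hθ : ∀ k, IsProbabilityMeasure (θ k).law) {Q : Measure (OutlierData p n S)}
    [IsProbabilityMeasure Q] : IsProbabilityMeasure (dataLaw n S θ Q) :=
  Measure.isProbabilityMeasure_map (MeasurableEquiv.measurable _).aemeasurable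

lemma chiBound_dataLaw {θ θ₀ : {k // k ∈ S} → GMMParam p}
    (hθ : ∀ k, IsProbabilityMeasure (θ k).law) (hθ₀ : ∀ k, IsProbabilityMeasure (θ₀ k).law)
    {Q : Measure (OutlierData p n S)} [IsProbabilityMeasure Q] {b : {k // k ∈ S} → ℝ}
    (h : ∀ k, ChiBound (θ k).law (θ₀ k).law (ENNReal.ofReal (Real.exp (b k)))) :
    ChiBound (dataLaw n S θ Q) (dataLaw n S θ₀ Q)
      (ENNReal.ofReal (Real.exp (∑ k : {k // k ∈ S}, n k * b k))) := by
  have h1 : ∀ k : {k // k ∈ S}, ChiBound (Measure.pi fun _ : Fin (n k) => (θ k).law)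
      (Measure.pi fun _ : Fin (n k) => (θ₀ k).law)
      (ENNReal.ofReal (Real.exp (n k * b k))) := fun k => by
    have := ChiBound.pi (fun _ : Fin (n k) => h k)
    rwa [Finset.prod_const, Finset.card_univ, Fintype.card_fin,
      ← ENNReal.ofReal_pow (Real.exp_nonneg _), ← Real.exp_nat_mul] at this
  have h2 := ((ChiBound.pi h1).prod (ChiBound.refl Q)).map (MeasurableEquiv.piEquivPiSubtypeProd
    (fun k : Fin K => Fin (n k) → EuclideanSpace ℝ (Fin p)) (fun k => k ∈ S)).symm.measurable
  rwa [mul_one, ← ENNReal.ofReal_prod_of_nonneg fun i _ => Real.exp_nonneg _,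
    ← Real.exp_sum] at h2

/-- Each term in the expansion of a product of contaminated task laws is thereby an admissible
model, its outliers drawn from the contaminating laws. -/
lemma pi_eq_dataLaw (θ : GMMParam p) [IsProbabilityMeasure θ.law]
    (q : ∀ k, Measure (Fin (n k) → EuclideanSpace ℝ (Fin p))) [∀ k, IsProbabilityMeasure (q k)] :
    Measure.pi (fun k => if k ∈ S then Measure.pi (fun _ : Fin (n k) => θ.law) else q k) =
      dataLaw n S (fun _ => θ) (Measure.pi fun k : {k // k ∉ S} => q k) := by
  have : ∀ k, IsProbabilityMeasure
      (if k ∈ S then Measure.pi (fun _ : Fin (n k) => θ.law) else q k) := by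
    intro k; split_ifs <;> infer_instance
  have h := ((measurePreserving_piEquivPiSubtypeProd (fun k =>
    if k ∈ S then Measure.pi (fun _ : Fin (n k) => θ.law) else q k) (fun k => k ∈ S)).symm
    (MeasurableEquiv.piEquivPiSubtypeProd _ _)).map_eq
  rw [← h, dataLaw]
  congr 3
  · exact Subsingleton.elim _ _
  · funext k; rw [if_pos k.2]
  · funext k; rw [if_neg k.2]

/-- Finitely many hypotheses that cannot be told apart but are separated for the loss of some task
force a large loss. -/
lemma exists_le_dataLaw {ι : Type*} [Fintype ι] {θ : ι → {k // k ∈ S} → GMMParam p}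
    {θ₀ : {k // k ∈ S} → GMMParam p} {Q : Measure (OutlierData p n S)} [IsProbabilityMeasure Q]
    (hθ : ∀ i k, IsProbabilityMeasure (θ i k).law) (hθ₀ : ∀ k, IsProbabilityMeasure (θ₀ k).law)
    {b : ι → {k // k ∈ S} → ℝ}
    (h : ∀ i k, ChiBound (θ i k).law (θ₀ k).law (ENNReal.ofReal (Real.exp (b i k))))
    (hcard : 2 ≤ Fintype.card ι) (hb : ∀ i, 2 * ∑ k : {k // k ∈ S}, n k * b i k ≤ Real.log (Fintype.card ι))
    {loss : Fin K → Data p n → GMMParam p → ℝ} (hl : ∀ k ϑ, Measurable fun z => loss k z ϑ)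
    {D : GMMParam p → GMMParam p → ℝ} (hD : ∀ k z ϑ ϑ', D ϑ ϑ' ≤ loss k z ϑ + loss k z ϑ')
    {t : Fin K → ℝ} (hsep : ∀ i j, i ≠ j → ∃ k : {k // k ∈ S}, 2 * t k ≤ D (θ i k) (θ j k)) :
    ∃ i, (1 / 10 : ℝ≥0∞) ≤ dataLaw n S (θ i) Q (⋃ k : {k // k ∈ S}, {z | t k ≤ loss k z (θ i k)}) := by
  have hc0 : (0 : ℝ) < Fintype.card ι := by exact_mod_cast (by omega : 0 < Fintype.card ι)
  have hm : ∀ i, MeasurableSet (⋃ k : {k // k ∈ S}, {z | t k ≤ loss k z (θ i k)}) := fun i =>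
    MeasurableSet.iUnion fun k => measurableSet_le measurable_const (hl _ _)
  have := isProbabilityMeasure_dataLaw (n := n) hθ₀ (Q := Q)
  have := fun i => isProbabilityMeasure_dataLaw (n := n) (hθ i) (Q := Q)
  -- The constant is the square root of the number of hypotheses. The events where all losses are
  -- below the threshold are disjoint by separation and the triangle inequality.
  have h1 := ChiBound.exists_le_compl (P := fun i => dataLaw n S (θ i) Q)
    (Q := dataLaw n S θ₀ Q) (B := Real.exp (Real.log (Fintype.card ι) / 2)) (Real.exp_nonneg _)
    hcard (by rw [← Real.exp_nat_mul]; push_cast; rw [mul_div_cancel₀ _ two_ne_zero, Real.exp_log hc0])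
    (fun i => (chiBound_dataLaw (hθ i) hθ₀ (h i)).mono (by
      gcongr
      linarith [hb i]))
    (A := fun i => (⋃ k : {k // k ∈ S}, {z | t k ≤ loss k z (θ i k)})ᶜ)
    (fun i => (hm i).compl) (fun i j hij => by
      rw [Function.onFun, Set.disjoint_left]
      intro z hz hz'
      obtain ⟨k, hk⟩ := hsep i j hij
      simp only [Set.mem_compl_iff, Set.mem_iUnion, Set.mem_ofPred_eq, not_exists, not_le] at hz hz'
      linarith [hz k, hz' k, hD k z (θ i k) (θ j k)])
  simpa only [compl_compl] using h1

/-- Lower bound for hypotheses that perturb the parameter of a single task. -/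
lemma exists_le_dataLaw_single {A : Finset (Fin K)} (hAS : A ⊆ S) (hA : A.Nonempty)
    {T : Type*} [Zero T] [DecidableEq T] {V : Finset T} (hV : 2 ≤ V.card) (hV0 : (0 : T) ∉ V)
    {ϑ : ℝ → T → GMMParam p} {θ₀ : GMMParam p} (hbase : ∀ x, ϑ x 0 = θ₀) {r : Fin K → ℝ} {κ : ℝ}
    (hp : ∀ k ∈ A, ∀ v ∈ insert 0 V, IsProbabilityMeasure (ϑ (r k) v).law)
    (hchi : ∀ k ∈ A, ∀ v ∈ V,
      ChiBound (ϑ (r k) v).law θ₀.law (ENNReal.ofReal (Real.exp (κ * r k ^ 2))))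
    (hn : ∀ k ∈ A, 2 * (n k * (κ * r k ^ 2)) ≤ Real.log (A.card * V.card))
    {loss : Fin K → Data p n → GMMParam p → ℝ} (hl : ∀ k ϑ, Measurable fun z => loss k z ϑ)
    {D : GMMParam p → GMMParam p → ℝ} (hD : ∀ k z ϑ ϑ', D ϑ ϑ' ≤ loss k z ϑ + loss k z ϑ')
    {t : Fin K → ℝ} (hsep : ∀ k ∈ A, ∀ v ∈ insert 0 V, ∀ v' ∈ insert 0 V, v ≠ v' →
      2 * t k ≤ D (ϑ (r k) v) (ϑ (r k) v')) :
    ∃ j ∈ A, ∃ v ∈ V, (1 / 10 : ℝ≥0∞) ≤ dataLaw n S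
      (fun k => ϑ (r k) (if (k : Fin K) = j then v else 0)) (Measure.dirac 0)
      (⋃ k : {k // k ∈ S}, {z | t k ≤ loss k z (ϑ (r k) (if (k : Fin K) = j then v else 0))}) := by
  obtain ⟨k₀, hk₀⟩ := hA
  have hp₀ : IsProbabilityMeasure θ₀.law := hbase (r k₀) ▸ hp k₀ hk₀ 0 (Finset.mem_insert_self _ _)
  have hcard : Fintype.card (A × V) = A.card * V.card := by simp
  obtain ⟨⟨j, v⟩, h⟩ := exists_le_dataLaw (S := S) (ι := A × V) (Q := Measure.dirac 0)
    (θ := fun i k => ϑ (r k) (if (k : Fin K) = i.1 then i.2 else 0)) (θ₀ := fun _ => θ₀)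
    (fun i k => by
      split_ifs with hk
      · exact hp _ (hk ▸ i.1.2) _ (Finset.mem_insert_of_mem i.2.2)
      · rw [hbase]; exact hp₀)
    (fun _ => hp₀) (b := fun i k => if (k : Fin K) = i.1 then κ * r k ^ 2 else 0)
    (fun i k => by
      split_ifs with hk
      · exact hchi _ (hk ▸ i.1.2) _ i.2.2
      · rw [hbase, Real.exp_zero, ENNReal.ofReal_one]; exact ChiBound.refl _)
    (by
      rw [hcard]
      have : 0 < A.card := Finset.card_pos.2 ⟨k₀, hk₀⟩
      nlinarith)
    (fun i => by
      rw [hcard, Finset.sum_eq_single ⟨i.1, hAS i.1.2⟩]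
      · simpa using hn _ i.1.2
      · intro k _ hk
        rw [if_neg, mul_zero]
        exact fun h => hk (Subtype.ext h)
      · simp)
    -- Task j tells (j, v) from (j', v'): if j = j' it compares v with v', otherwise v with 0. This
    -- is why the packing must also stay away from the origin.
    hl hD (t := t) (by
      rintro ⟨j, v⟩ ⟨j', v'⟩ hne
      by_cases hj : j = j'
      · subst hj
        refine ⟨⟨j, hAS j.2⟩, ?_⟩
        simp only [if_true]
        exact hsep _ j.2 _ (Finset.mem_insert_of_mem v.2) _ (Finset.mem_insert_of_mem v'.2)
          (fun h => hne (by rw [Subtype.ext h]))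
      · refine ⟨⟨j, hAS j.2⟩, ?_⟩
        have : (j : Fin K) ≠ j' := fun h => hj (Subtype.ext h)
        simp only [if_true, this, if_false]
        exact hsep _ j.2 _ (Finset.mem_insert_of_mem v.2) _ (Finset.mem_insert_self _ _)
          (fun h => hV0 (h ▸ v.2)))
  exact ⟨j, j.2, v, v.2, h⟩

/-- Lower bound for hypotheses under which all tasks share the same parameter. -/
lemma exists_le_dataLaw_common {k₀ : Fin K} (hk₀ : k₀ ∈ S) {T : Type*} {V : Finset T}
    (hV : 2 ≤ V.card) {ϑ : T → GMMParam p} {θ₀ : GMMParam p} [IsProbabilityMeasure θ₀.law]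
    (hp : ∀ v ∈ V, IsProbabilityMeasure (ϑ v).law) {b : ℝ}
    (hchi : ∀ v ∈ V, ChiBound (ϑ v).law θ₀.law (ENNReal.ofReal (Real.exp b)))
    (hn : 2 * (((∑ k ∈ S, n k : ℕ) : ℝ) * b) ≤ Real.log V.card)
    {loss : Fin K → Data p n → GMMParam p → ℝ} (hl : ∀ k ϑ, Measurable fun z => loss k z ϑ)
    {D : GMMParam p → GMMParam p → ℝ} (hD : ∀ k z ϑ ϑ', D ϑ ϑ' ≤ loss k z ϑ + loss k z ϑ')
    {t : Fin K → ℝ} (hsep : ∀ v ∈ V, ∀ v' ∈ V, v ≠ v' → 2 * t k₀ ≤ D (ϑ v) (ϑ v')) :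
    ∃ v ∈ V, (1 / 10 : ℝ≥0∞) ≤ dataLaw n S (fun _ => ϑ v) (Measure.dirac 0)
      (⋃ k : {k // k ∈ S}, {z | t k ≤ loss k z (ϑ v)}) := by
  obtain ⟨v, h⟩ := exists_le_dataLaw (S := S) (ι := V) (Q := Measure.dirac 0)
    (θ := fun v _ => ϑ v) (θ₀ := fun _ => θ₀) (fun v _ => hp v v.2) (fun _ => inferInstance)
    (b := fun _ _ => b) (fun v _ => hchi v v.2) (by simpa using hV)
    (fun v => by
      rw [Fintype.card_coe, ← Finset.sum_mul, Finset.sum_coe_sort S (fun k => (n k : ℝ))]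
      push_cast at hn
      exact hn)
    hl hD (t := t) (fun v v' hne => ⟨⟨k₀, hk₀⟩, hsep v v.2 v' v'.2 fun h => hne (Subtype.ext h)⟩)
  exact ⟨v, v.2, h⟩

lemma real_pi_contaminated_le {s : ℕ} (hs : 0 < s) (hsK : s ≤ K) {k₀ : Fin K} {θ : GMMParam p}
    [IsProbabilityMeasure θ.law] {q : ∀ k, Measure (Fin (n k) → EuclideanSpace ℝ (Fin p))}
    [∀ k, IsProbabilityMeasure (q k)] {η : ℝ} (hη : η = (K - s) / (10 * K)) {E : Set (Data p n)}
    (H : ∀ S : Finset (Fin K), s ≤ S.card → k₀ ∈ S → ∀ Q : Measure (OutlierData p n S),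
      IsProbabilityMeasure Q → dataLaw n S (fun _ => θ) Q E < 1 / 10) :
    (Measure.pi fun k => ENNReal.ofReal (1 - η) • Measure.pi (fun _ : Fin (n k) => θ.law) +
      ENNReal.ofReal η • q k).real E ≤ 3 / 10 := by
  have hK : (0 : ℝ) < K := by exact_mod_cast hs.trans_le hsK
  have hsK' : (s : ℝ) ≤ K := by exact_mod_cast hsK
  have hs0 : (0 : ℝ) ≤ s := by positivity
  have h0 : 0 ≤ η := by rw [hη]; exact div_nonneg (by linarith) (by positivity)
  have hKη : K * η = (K - s) / 10 := by rw [hη]; field_simp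
  have h1 : η ≤ 1 / 10 := by rw [hη, div_le_div_iff₀ (by positivity) (by norm_num)]; linarith
  set w : Finset (Fin K) → ℝ := fun S => (1 - η) ^ S.card * η ^ (Fintype.card (Fin K) - S.card)
  have hw : ∀ S, 0 ≤ w S := fun S => mul_nonneg (pow_nonneg (by linarith) _) (pow_nonneg h0 _)
  set P : Finset (Fin K) → Measure (Data p n) := fun S =>
    Measure.pi fun k => if k ∈ S then Measure.pi (fun _ : Fin (n k) => θ.law) else q k
  have : ∀ (S : Finset (Fin K)) k, IsProbabilityMeasure
      (if k ∈ S then Measure.pi (fun _ : Fin (n k) => θ.law) else q k) := by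
    intro S k; split_ifs <;> infer_instance
  have hP : ∀ S, IsProbabilityMeasure (P S) := fun S => inferInstance
  have hexp : (Measure.pi fun k => ENNReal.ofReal (1 - η) •
      Measure.pi (fun _ : Fin (n k) => θ.law) + ENNReal.ofReal η • q k).real E =
      ∑ S, w S * (P S).real E := by
    rw [pi_smul_add_smul _ _ ENNReal.ofReal_ne_top ENNReal.ofReal_ne_top, measureReal_def,
      Measure.coe_finsetSum, Finset.sum_apply, ENNReal.toReal_sum]
    · refine Finset.sum_congr rfl fun S _ => ?_
      rw [Measure.smul_apply, smul_eq_mul, ENNReal.toReal_mul, ENNReal.toReal_mul,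
        ENNReal.toReal_pow, ENNReal.toReal_pow, ENNReal.toReal_ofReal (by linarith),
        ENNReal.toReal_ofReal h0]
      rfl
    · intro S _
      rw [Measure.smul_apply, smul_eq_mul]
      exact ENNReal.mul_ne_top (ENNReal.mul_ne_top (ENNReal.pow_ne_top ENNReal.ofReal_ne_top)
        (ENNReal.pow_ne_top ENNReal.ofReal_ne_top)) (measure_ne_top (P S) E)
  have hgood : ∀ S, (k₀ ∈ S ∧ Sᶜ.card ≤ K - s) → (P S).real E ≤ 1 / 10 := by
    rintro S ⟨hk, hS⟩
    rw [Finset.card_compl, Fintype.card_fin] at hS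
    have hcard : S.card ≤ K := by simpa using S.card_le_univ
    have h2 := H S (by omega) hk (Measure.pi fun k : {k // k ∉ S} => q k) inferInstance
    rw [← pi_eq_dataLaw] at h2
    have := (ENNReal.toReal_lt_toReal (measure_ne_top (P S) E) (by simp)).2 h2
    simpa [measureReal_def] using this.le
  -- Good sets keep the task k₀, on which the loss is measured, and leave out at most K − s tasks.
  have hbad : ∑ S with ¬ (k₀ ∈ S ∧ Sᶜ.card ≤ K - s), w S ≤
      η + Fintype.card (Fin K) * η / ((K - s : ℕ) + 1) := sum_bad_subsets_le h0 (by linarith) k₀ (K - s)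
  rw [hexp]
  calc ∑ S, w S * (P S).real E
      ≤ ∑ S, (w S * (1 / 10) + if ¬ (k₀ ∈ S ∧ Sᶜ.card ≤ K - s) then w S else 0) := by
        refine Finset.sum_le_sum fun S _ => ?_
        by_cases hS : k₀ ∈ S ∧ Sᶜ.card ≤ K - s
        · rw [if_neg (not_not.2 hS), add_zero]
          exact mul_le_mul_of_nonneg_left (hgood S hS) (hw S)
        · rw [if_pos hS]
          have : w S * (P S).real E ≤ w S * 1 :=
            mul_le_mul_of_nonneg_left measureReal_le_one (hw S)
          linarith [hw S]
    _ = 1 / 10 + ∑ S with ¬ (k₀ ∈ S ∧ Sᶜ.card ≤ K - s), w S := by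
        rw [Finset.sum_add_distrib, ← Finset.sum_mul, sum_subsets, one_mul, Finset.sum_filter]
    _ ≤ 1 / 10 + (η + K * η / ((K - s : ℕ) + 1)) := by
        rw [Fintype.card_fin] at hbad
        exact add_le_add_right hbad (1 / 10)
    -- The factor 10 in η is spent here: k₀ is contaminated with probability η ≤ 1/10, and the
    -- expected number of outlier tasks is (K − s)/10.
    _ ≤ 1 / 10 + (1 / 10 + 1 / 10) := by
        have : K * η / (((K - s : ℕ) : ℝ) + 1) ≤ 1 / 10 := by
          rw [hKη, Nat.cast_sub hsK, div_le_div_iff₀ (by linarith) (by norm_num)]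
          linarith
        linarith
    _ = 3 / 10 := by norm_num

/-- Two parameters that are indistinguishable up to the contamination of a few tasks force a large
loss. -/
lemma exists_le_dataLaw_contaminated {s : ℕ} (hs : 0 < s) (hsK : s < K) (k₀ : Fin K)
    (θ : Bool → GMMParam p) [∀ i, IsProbabilityMeasure (θ i).law]
    (hTV : ∀ k, ∀ A, MeasurableSet A →
      (Measure.pi (fun _ : Fin (n k) => (θ true).law)).real A ≤
        (Measure.pi (fun _ : Fin (n k) => (θ false).law)).real A + (K - s) / (10 * K))
    {E : Bool → Set (Data p n)} (hE : E false ∪ E true = Set.univ) :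
    ∃ (i : Bool) (S : Finset (Fin K)), s ≤ S.card ∧ k₀ ∈ S ∧
      ∃ Q : Measure (OutlierData p n S), IsProbabilityMeasure Q ∧
        1 / 10 ≤ dataLaw n S (fun _ => θ i) Q (E i) := by
  by_contra! hcon
  set η : ℝ := (K - s) / (10 * K) with hη
  have hK : (0 : ℝ) < K := by exact_mod_cast hs.trans hsK
  have hsK' : (s : ℝ) < K := by exact_mod_cast hsK
  have hs0 : (0 : ℝ) ≤ s := by positivity
  have h0 : 0 < η := div_pos (by linarith) (by positivity)
  have h1 : η < 1 := by rw [hη, div_lt_one (by positivity)]; linarith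
  choose q q' hq hq' hqq' using fun k => exists_contamination
    (Measure.pi (fun _ : Fin (n k) => (θ false).law))
    (Measure.pi (fun _ : Fin (n k) => (θ true).law)) h0 h1 (hTV k)
  have h2 := real_pi_contaminated_le hs hsK.le (k₀ := k₀) (θ := θ false) (q := q) hη
    (E := E false) (hcon false)
  have h3 := real_pi_contaminated_le hs hsK.le (k₀ := k₀) (θ := θ true) (q := q') hη
    (E := E true) (hcon true)
  -- After contamination both parameters generate the same measure m, under which the two events
  -- have total probability at most 6/10 although they cover the space.
  simp only [← hqq'] at h3
  set m := Measure.pi fun k => ENNReal.ofReal (1 - η) •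
    Measure.pi (fun _ : Fin (n k) => (θ false).law) + ENNReal.ofReal η • q k
  have hmk : ∀ k, IsProbabilityMeasure (ENNReal.ofReal (1 - η) •
      Measure.pi (fun _ : Fin (n k) => (θ false).law) + ENNReal.ofReal η • q k) := fun k => by
    constructor
    rw [Measure.add_apply, Measure.smul_apply, Measure.smul_apply, measure_univ, measure_univ,
      smul_eq_mul, smul_eq_mul, mul_one, mul_one, ← ENNReal.ofReal_add (by linarith) h0.le,
      sub_add_cancel, ENNReal.ofReal_one]
  have hm : IsProbabilityMeasure m := inferInstance
  have h4 := measureReal_union_le (μ := m) (E false) (E true)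
  rw [hE, probReal_univ] at h4
  linarith

end dataLaw

/-! ### The single-task scheme and the choice of constants -/

/-- Using only a sixteenth of the tasks costs 4 log 2, and 1 + 4 log 2 ≤ 6 log 2 makes the factor 6
suffice already for q = 1. -/
lemma add_log_le {q K a V : ℕ} (hq : 1 ≤ q) (hK : 0 < K) (hKa : K ≤ 16 * a) (hV : 2 ^ q ≤ V) :
    (q : ℝ) + Real.log K ≤ 6 * Real.log (a * V) := by
  have ha : (1 : ℝ) ≤ a := by exact_mod_cast (by omega : 1 ≤ a)
  have hV' : (2 : ℝ) ^ q ≤ V := by exact_mod_cast hV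
  have hK' : (0 : ℝ) < K := by exact_mod_cast hK
  have h2q : (0 : ℝ) < 2 ^ q := by positivity
  have h1 : Real.log K ≤ 4 * Real.log 2 + Real.log a := by
    have : (K : ℝ) ≤ 2 ^ 4 * a := by norm_num; exact_mod_cast hKa
    calc Real.log K ≤ Real.log (2 ^ 4 * a) := Real.log_le_log hK' this
      _ = _ := by rw [Real.log_mul (by norm_num) (by positivity), Real.log_pow]; norm_num
  have h2 : q * Real.log 2 ≤ Real.log V := by
    rw [← Real.log_pow]; exact Real.log_le_log h2q hV'
  have h3 : 0 ≤ Real.log a := Real.log_nonneg ha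
  rw [Real.log_mul (by positivity) (h2q.trans_le hV').ne']
  have h4 := Real.log_two_gt_d9
  have hq' : (1 : ℝ) ≤ q := by exact_mod_cast hq
  nlinarith

lemma sqrt_div_le_one {x : ℝ} {n : ℕ} (h : x ≤ n) : √(x / n) ≤ 1 := by
  rw [Real.sqrt_le_one]
  exact div_le_one_of_le₀ h (by positivity)

/-- The hypotheses perturbing a single task, as elements of the joint parameter space. -/
lemma exists_mem_jointSpace_single {p K : ℕ} {n : Fin K → ℕ} {M cw cS hw hμ hβ b κ : ℝ}
    (hcw : 0 < cw) (hK : 0 < K) (hn : ∀ k, 0 < n k) (hw0 : 0 ≤ hw) (hμ0 : 0 ≤ hμ) (hβ0 : 0 ≤ hβ)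
    (hb : 0 ≤ b) (hκb : κ * b ^ 2 ≤ 1 / 400)
    {S A : Finset (Fin K)} (hAS : A ⊆ S) (hA : K ≤ 16 * A.card)
    {T : Type*} [Zero T] [DecidableEq T] {V : Finset T} {q : ℕ} (hq : 1 ≤ q) (hV : 2 ^ q ≤ V.card)
    (hV0 : (0 : T) ∉ V) {ϑ : ℝ → T → GMMParam p} {θ₀ : GMMParam p} (hbase : ∀ x, ϑ x 0 = θ₀)
    {rt : Fin K → ℝ} (hrt0 : ∀ k, 0 ≤ rt k) (hrt1 : ∀ k ∈ A, rt k ≤ 1)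
    (hrtn : ∀ k ∈ A, rt k ≤ √((q + Real.log K) / n k))
    (hmem : ∀ r, 0 ≤ r → r ≤ b → ∀ v ∈ insert 0 V, ϑ r v ∈ singleSpace p M cw cS)
    (hclose : ∀ k ∈ A, ∀ v ∈ insert 0 V, |(ϑ (b * rt k) v).w - θ₀.w| ≤ hw ∧
      ‖(ϑ (b * rt k) v).μ₁ - θ₀.μ₁‖ ≤ hμ ∧ ‖(ϑ (b * rt k) v).μ₂ - θ₀.μ₂‖ ≤ hμ ∧
      ‖(ϑ (b * rt k) v).beta - θ₀.beta‖ ≤ hβ)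
    (hchi : ∀ r, 0 ≤ r → r ≤ b → ∀ v ∈ V,
      ChiBound (ϑ r v).law θ₀.law (ENNReal.ofReal (Real.exp (κ * r ^ 2))))
    {loss : Fin K → Data p n → GMMParam p → ℝ} (hl : ∀ k ϑ, Measurable fun z => loss k z ϑ)
    {D : GMMParam p → GMMParam p → ℝ} (hD : ∀ k z ϑ ϑ', D ϑ ϑ' ≤ loss k z ϑ + loss k z ϑ')
    (hsep : ∀ r, 0 ≤ r → r ≤ b → ∀ v ∈ insert 0 V, ∀ v' ∈ insert 0 V, v ≠ v' →
      r ≤ 16 * D (ϑ r v) (ϑ r v'))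
    {t : Fin K → ℝ} (ht : ∀ k ∈ A, 32 * t k ≤ b * rt k) :
    ∃ θ ∈ jointSpace (p := p) M cw cS S hw hμ hβ,
      ∃ Q : Measure (OutlierData p n S), IsProbabilityMeasure Q ∧
        1 / 10 ≤ dataLaw n S θ Q (⋃ k : {k // k ∈ S}, {z | t k ≤ loss k z (θ k)}) := by
  have hAne : A.Nonempty := Finset.card_pos.1 (by omega)
  have hr0 : ∀ k, 0 ≤ b * rt k := fun k => mul_nonneg hb (hrt0 k)
  have hrb : ∀ k ∈ A, b * rt k ≤ b := fun k hk => mul_le_of_le_one_right hb (hrt1 k hk)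
  have h2V : 2 ≤ V.card := le_trans (by calc 2 = 2 ^ 1 := rfl
                                       _ ≤ 2 ^ q := Nat.pow_le_pow_right (by norm_num) hq) hV
  obtain ⟨j, hj, v, hv, h⟩ := exists_le_dataLaw_single hAS hAne h2V hV0 hbase
    (r := fun k => b * rt k) (κ := κ)
    (fun k hk v hv => isProbabilityMeasure_law_of_mem hcw (hmem _ (hr0 k) (hrb k hk) v hv))
    (fun k hk v hv => hchi _ (hr0 k) (hrb k hk) v hv)
    -- The χ² budget: n_k r² is at most b²(q + log K), and 2/400 · 6 is well below one.
    (fun k hk => by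
      have hlog := add_log_le hq hK hA hV
      have hnk : (0 : ℝ) < n k := by exact_mod_cast hn k
      have hKlog : 0 ≤ Real.log K := Real.log_natCast_nonneg K
      have h1 : rt k ^ 2 ≤ (q + Real.log K) / n k := by
        rw [← Real.sq_sqrt (by positivity : 0 ≤ (q + Real.log K) / n k)]
        gcongr
        exacts [hrt0 k, hrtn k hk]
      have h2 : n k * rt k ^ 2 ≤ q + Real.log K := by
        rw [le_div_iff₀ hnk] at h1; linarith
      have h0 : 0 ≤ n k * rt k ^ 2 := by positivity
      calc 2 * (n k * (κ * (b * rt k) ^ 2)) = 2 * (κ * b ^ 2) * (n k * rt k ^ 2) := by ring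
        _ ≤ 2 * (1 / 400) * (q + Real.log K) := by gcongr
        _ ≤ _ := by linarith)
    hl hD (t := t) (fun k hk v hv v' hv' hne => by
      have := hsep _ (hr0 k) (hrb k hk) v hv v' hv' hne
      have := ht k hk
      linarith)
  have h0mem : θ₀ ∈ singleSpace p M cw cS :=
    hbase 0 ▸ hmem 0 le_rfl hb 0 (Finset.mem_insert_self _ _)
  refine ⟨_, mem_jointSpace θ₀ hw0 hμ0 hβ0 ?_ ?_ ?_ ?_ ?_, Measure.dirac 0, inferInstance, h⟩
  · intro k
    split_ifs with hk
    · exact hmem _ (hr0 k) (hrb _ (hk ▸ hj)) v (Finset.mem_insert_of_mem hv)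
    · rw [hbase]; exact h0mem
  all_goals
    intro k
    split_ifs with hk
    · have := hclose k (hk ▸ hj) v (Finset.mem_insert_of_mem hv)
      tauto
    · rw [hbase]; simpa

/-- One small b meets all demands: the families stay in the parameter space, and both κ = 4 and κ =
1/M² fit the χ² budget. -/
lemma exists_scale {M cw cS : ℝ} (hM : 0 < M) (hcw' : cw < 1 / 2) (hcS : 1 < cS) :
    ∃ b > (0 : ℝ), b < 1 / 2 - cw ∧ b ≤ M / 2 ∧ b / (2 * M) ≤ 1 / 8 ∧
      2 * (b / (2 * M)) ≤ 1 - cS⁻¹ ∧ b ≤ 1 / 8 ∧ 2 * b ≤ 1 - cS⁻¹ ∧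
      (4 + 1 / M ^ 2) * b ^ 2 ≤ 1 / 400 := by
  have hS : 0 < 1 - cS⁻¹ := by
    have := inv_lt_one_of_one_lt₀ hcS
    linarith
  set κ := 4 + 1 / M ^ 2
  have hκ4 : 4 ≤ κ := by
    have : 0 ≤ 1 / M ^ 2 := by positivity
    linarith
  have hev : ∀ {x : ℝ}, 0 < x → ∀ᶠ b in nhdsWithin (0 : ℝ) (Set.Ioi 0), b < x := fun {x} hx =>
    (Ioo_mem_nhdsGT hx : Set.Ioo 0 x ∈ nhdsWithin (0 : ℝ) (Set.Ioi 0)) |> fun h =>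
      Filter.mem_of_superset h fun b hb => hb.2
  have h1 := hev (by linarith : 0 < 1 / 2 - cw)
  have h2 := hev (by linarith : 0 < M / 2)
  have h3 := hev (by positivity : 0 < M / 4)
  have h4 := hev (mul_pos hM hS)
  have h5 := hev (by norm_num : (0 : ℝ) < 1 / 8)
  have h6 := hev (by linarith : 0 < (1 - cS⁻¹) / 2)
  have h7 := hev (by positivity : 0 < 1 / (20 * κ))
  obtain ⟨b, hb1, hb2, hb3, hb4, hb5, hb6, hb7, hb0⟩ := (h1.and (h2.and (h3.and (h4.and (h5.and
    (h6.and (h7.and self_mem_nhdsWithin))))))).exists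
  have hb0 : 0 < b := hb0
  refine ⟨b, hb0, hb1, hb2.le, ?_, ?_, hb5.le, by linarith, ?_⟩
  · rw [div_le_iff₀ (by positivity)]; linarith
  · rw [mul_comm 2 M, ← div_div, mul_div_cancel₀ _ two_ne_zero, div_le_iff₀ hM]; linarith
  · rw [lt_div_iff₀ (by positivity)] at hb7
    have h8 : (κ * b) ^ 2 ≤ (1 / 20) ^ 2 := by
      gcongr
      linarith
    have : κ * b ^ 2 * 1 ≤ κ * b ^ 2 * κ := by gcongr; linarith
    nlinarith

/-- Pigeonhole over the five summands. The factor 5, with the 32 from two-point separation, makes up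
the 160 in the final constant. -/
lemma rate_le_or {K : ℕ} {p s : ℕ} {n : Fin K → ℕ} {hw hμ hβ : ℝ} {S : Finset (Fin K)}
    (k : Fin K) :
    rate p s n hw hμ hβ S k ≤ 5 * √((p : ℝ) / ((∑ j ∈ S, n j : ℕ) : ℝ)) ∨
    rate p s n hw hμ hβ S k ≤ 5 * ((((K : ℝ) - s) / s) / √((Finset.univ.sup n : ℕ) : ℝ)) ∨
    rate p s n hw hμ hβ S k ≤ 5 * min hw (√((1 + Real.log K) / n k)) ∨
    rate p s n hw hμ hβ S k ≤ 5 * min hμ (√((p + Real.log K) / n k)) ∨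
    rate p s n hw hμ hβ S k ≤ 5 * min hβ (√((p + Real.log K) / n k)) := by
  by_contra! h
  obtain ⟨h1, h2, h3, h4, h5⟩ := h
  unfold rate at h1 h2 h3 h4 h5
  linarith

/-! ### The common and the contamination part of the rate -/

section rates

variable {p K s : ℕ} {n : Fin K → ℕ} {M cw cS hw hμ hβ b : ℝ}

lemma meanFam_sep {m r : ℝ} {e v v' : EuclideanSpace ℝ (Fin p)} (hr : 0 ≤ r)
    (hv : 1 / 4 ≤ ‖v - v'‖) :
    r ≤ 16 * paramDist (meanFam m e r v).disc (meanFam m e r v').disc := by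
  have h := norm_μ₁_sub_le_paramDist (meanFam m e r v) (meanFam m e r v')
  have h1 : (meanFam m e r v).μ₁ - (meanFam m e r v').μ₁ = r • (v - v') := by
    simp only [meanFam]; module
  rw [h1, norm_smul, Real.norm_of_nonneg hr] at h
  nlinarith

lemma wFam_sep {m r : ℝ} {e : EuclideanSpace ℝ (Fin p)} {v v' : ℝ} (hr : 0 ≤ r)
    (hv : 1 ≤ |v - v'|) :
    r ≤ 16 * paramDist (wFam m e r v).disc (wFam m e r v').disc := by
  have h := abs_w_sub_le_paramDist (wFam m e r v) (wFam m e r v')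
  have h1 : (wFam m e r v).w - (wFam m e r v').w = r * (v - v') := by
    simp only [wFam]; ring
  rw [h1, abs_mul, abs_of_nonneg hr] at h
  nlinarith

/-- With means ±(M/2)e, β is M times the image of e; the scale r/(2M) makes β move by an amount of
order r. -/
lemma covFam_sep {r : ℝ} {e v v' : EuclideanSpace ℝ (Fin p)} (hM : 0 < M) (hr : 0 ≤ r)
    (hr' : r / (2 * M) ≤ 1 / 8) (he : ‖e‖ = 1) (hv1 : ‖v‖ ≤ 1) (hv1' : ‖v'‖ ≤ 1)
    (hv : 1 / 4 ≤ ‖v - v'‖) :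
    r ≤ 16 * paramDist (covFam (M / 2) e (r / (2 * M)) v).disc
      (covFam (M / 2) e (r / (2 * M)) v').disc := by
  have hρ : 0 ≤ r / (2 * M) := by positivity
  have h := norm_beta_sub_le_paramDist (covFam (M / 2) e (r / (2 * M)) v)
    (covFam (M / 2) e (r / (2 * M)) v')
  rw [covFam_beta he hv1 hρ hr', covFam_beta he hv1' hρ hr', ← smul_sub, norm_smul,
    mul_div_cancel₀ _ two_ne_zero, Real.norm_of_nonneg hM.le] at h
  have h2 : M * (r / (2 * M) * (1 / 4)) ≤ M * (r / (2 * M) * ‖v - v'‖) := by gcongr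
  have h3 := mul_le_mul_of_nonneg_left (norm_precMat_apply_sub (v := v) (v' := v') hρ he) hM.le
  have h4 : M * (r / (2 * M) * (1 / 4)) = r / 8 := by field_simp; ring
  linarith

/-- The lower bound by the common part of the rate. -/
lemma exists_mem_jointSpace_common (hp : 0 < p) (hcw : 0 < cw) (hcw' : cw < 1 / 2)
    (hcS : 1 < cS) (hw0 : 0 ≤ hw) (hμ0 : 0 ≤ hμ) (hβ0 : 0 ≤ hβ) (hb : 0 < b) (hbM : b ≤ M / 2)
    (hb4 : 4 * b ^ 2 ≤ 1 / 400) {S : Finset (Fin K)} {k : Fin K} (hk : k ∈ S) (hpn : p ≤ n k)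
    {t : Fin K → ℝ} (ht : 32 * t k ≤ b * √((p : ℝ) / ((∑ j ∈ S, n j : ℕ) : ℝ)))
    {θhat : Fin K → Data p n → DiscParam p} (hθ : ∀ k, Measurable (θhat k)) :
    ∃ θ ∈ jointSpace (p := p) M cw cS S hw hμ hβ,
      ∃ Q : Measure (OutlierData p n S), IsProbabilityMeasure Q ∧
        1 / 10 ≤ dataLaw n S θ Q
          (⋃ k : {k // k ∈ S}, {z | t k ≤ paramDist (θhat k z) (θ k).disc}) := by
  obtain ⟨V, hVc, -, hV1, hVs⟩ := exists_packing hp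
  set e : EuclideanSpace ℝ (Fin p) := EuclideanSpace.single ⟨0, hp⟩ 1
  have he : ‖e‖ = 1 := by simp [e]
  set N := ∑ j ∈ S, n j
  have hpN : p ≤ N := hpn.trans (Finset.single_le_sum (f := n) (fun _ _ => Nat.zero_le _) hk)
  have hN0 : (0 : ℝ) < N := by exact_mod_cast hp.trans_le hpN
  set r := b * √((p : ℝ) / N)
  have hr0 : 0 ≤ r := by positivity
  have hrb : r ≤ b := mul_le_of_le_one_right hb.le (sqrt_div_le_one (by exact_mod_cast hpN))
  have hmem : ∀ v, ‖v‖ ≤ 1 → meanFam (M / 2) e r v ∈ singleSpace p M cw cS := fun v hv =>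
    meanFam_mem (by linarith) hr0 (by linarith) hcw' hcS he hv
  have hprob := isProbabilityMeasure_law_of_mem hcw (hmem 0 (by simp))
  have h2V : 2 ≤ V.card := by
    rw [hVc]
    calc 2 = 2 ^ 1 := rfl
      _ ≤ 2 ^ p := Nat.pow_le_pow_right (by norm_num) hp
  obtain ⟨v, hv, h⟩ := exists_le_dataLaw_common hk h2V (ϑ := meanFam (M / 2) e r)
    (θ₀ := meanFam (M / 2) e r 0)
    (fun v hv => isProbabilityMeasure_law_of_mem hcw (hmem v (hV1 v hv)))
    (fun v hv => meanFam_chiBound hr0 (hV1 v hv))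
    (by
      have hlog := Real.log_two_gt_d9
      have hp0 : (0 : ℝ) ≤ p := by positivity
      have h1 : N * r ^ 2 = b ^ 2 * p := by
        rw [mul_pow, Real.sq_sqrt (by positivity)]; field_simp
      change 2 * ((N : ℝ) * r ^ 2) ≤ _
      rw [h1, hVc]
      push_cast
      rw [Real.log_pow]
      nlinarith)
    (loss := fun k z ϑ => paramDist (θhat k z) ϑ.disc)
    (fun k ϑ => measurable_paramDist (hθ k) _)
    (D := fun ϑ ϑ' => paramDist ϑ.disc ϑ'.disc)
    (fun k z ϑ ϑ' => paramDist_le _ _ _) (t := t)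
    (fun v hv v' hv' hne => by
      have := meanFam_sep (m := M / 2) (e := e) hr0 (hVs v (Finset.mem_insert_of_mem hv) v'
        (Finset.mem_insert_of_mem hv') hne)
      linarith)
  exact ⟨_, const_mem_jointSpace hw0 hμ0 hβ0 (hmem v (hV1 v hv)), Measure.dirac 0, inferInstance, h⟩

/-- The lower bound by the part of the rate that is due to contamination. -/
lemma exists_mem_jointSpace_contaminated (hp : 0 < p) (hs : 0 < s) (hsK : s < K)
    (hc : ((K : ℝ) - s) / s < 1 / 4) (hn : ∀ k, 0 < n k)
    (hcw : 0 < cw) (hcw' : cw < 1 / 2)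
    (hcS : 1 < cS) (hw0 : 0 ≤ hw) (hμ0 : 0 ≤ hμ) (hβ0 : 0 ≤ hβ) (hb : 0 < b) (hbM : b ≤ M / 2)
    (hb4 : 4 * b ^ 2 ≤ 1 / 400) (k : Fin K) {t : Finset (Fin K) → Fin K → ℝ}
    (ht : ∀ S, s ≤ S.card →
      32 * t S k ≤ b * ((((K : ℝ) - s) / s) / √((Finset.univ.sup n : ℕ) : ℝ)))
    (θhat : Fin K → Data p n → DiscParam p) :
    ∃ S : Finset (Fin K), s ≤ S.card ∧ ∃ θ ∈ jointSpace (p := p) M cw cS S hw hμ hβ,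
      ∃ Q : Measure (OutlierData p n S), IsProbabilityMeasure Q ∧
        1 / 10 ≤ dataLaw n S θ Q
          (⋃ k : {k // k ∈ S}, {z | t S k ≤ paramDist (θhat k z) (θ k).disc}) := by
  set e : EuclideanSpace ℝ (Fin p) := EuclideanSpace.single ⟨0, hp⟩ 1
  have he : ‖e‖ = 1 := by simp [e]
  set N := Finset.univ.sup n
  have hN1 : ∀ k, n k ≤ N := fun k => Finset.le_sup (Finset.mem_univ k)
  have hN0 : (1 : ℝ) ≤ N := by exact_mod_cast (hn k).trans_le (hN1 k)
  have hs0 : (0 : ℝ) < s := by exact_mod_cast hs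
  have hsK' : (s : ℝ) < K := by exact_mod_cast hsK
  have hK0 : (0 : ℝ) < K := hs0.trans hsK'
  set ε := ((K : ℝ) - s) / s with hε
  have hε0 : 0 ≤ ε := div_nonneg (by linarith) hs0.le
  have hsqrt : 1 ≤ √(N : ℝ) := Real.one_le_sqrt.2 hN0
  set δ := b * (ε / √(N : ℝ))
  have hδ0 : 0 ≤ δ := by positivity
  have hδb : δ ≤ b := by
    refine mul_le_of_le_one_right hb.le (div_le_one_of_le₀ ?_ (by positivity))
    linarith
  have hmem : ∀ v, ‖v‖ ≤ 1 → meanFam (M / 2) e δ v ∈ singleSpace p M cw cS := fun v hv =>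
    meanFam_mem (by linarith) hδ0 (by linarith) hcw' hcS he hv
  set θ : Bool → GMMParam p := fun i => meanFam (M / 2) e δ (if i then e else 0)
  have hθmem : ∀ i, θ i ∈ singleSpace p M cw cS := by
    intro i
    refine hmem _ ?_
    split_ifs
    · exact he.le
    · simp
  have hprob : ∀ i, IsProbabilityMeasure (θ i).law := fun i =>
    isProbabilityMeasure_law_of_mem hcw (hθmem i)
  set η : ℝ := (K - s) / (10 * K) with hη
  have hη0 : 0 ≤ η := div_nonneg (by linarith) (by positivity)
  have hη1 : η ≤ 1 := by rw [hη, div_le_one (by positivity)]; linarith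
  -- From ε < 1/4 one gets K < 5s/4, hence ε = 10(K/s)η ≤ 12.5 η.
  have hηε : ε ≤ 13 * η := by
    rw [div_lt_iff₀ hs0] at hc
    rw [hε, hη, ← mul_div_assoc, div_le_div_iff₀ hs0 (by positivity)]
    nlinarith
  have hTV : ∀ k, ∀ A, MeasurableSet A →
      (Measure.pi (fun _ : Fin (n k) => (θ true).law)).real A ≤
        (Measure.pi (fun _ : Fin (n k) => (θ false).law)).real A + η := by
    intro k A hA
    have h1 : ChiBound (θ true).law (θ false).law (ENNReal.ofReal (Real.exp (δ ^ 2))) := by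
      simpa [θ] using meanFam_chiBound (m := M / 2) (e := e) hδ0 he.le
    have h2 := ChiBound.pi (fun _ : Fin (n k) => h1)
    rw [Finset.prod_const, Finset.card_univ, Fintype.card_fin,
      ← ENNReal.ofReal_pow (Real.exp_nonneg _), ← Real.exp_nat_mul] at h2
    refine ChiBound.real_apply_le hη0 hη1 (h2.mono (ENNReal.ofReal_le_ofReal ?_)) hA
    have h3 : n k * δ ^ 2 ≤ b ^ 2 * ε ^ 2 := by
      have hnN : (n k : ℝ) ≤ N := by exact_mod_cast hN1 k
      calc n k * δ ^ 2 ≤ N * δ ^ 2 := by gcongr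
        _ = b ^ 2 * ε ^ 2 := by
          rw [mul_pow, div_pow, Real.sq_sqrt (by positivity)]; field_simp
    have h4 : ε ^ 2 ≤ (13 * η) ^ 2 := by gcongr
    -- As b² ≤ 1/1600, the product 169 b² is below 1/2; then exp x − 1 ≤ 2x gives the χ² bound η²
    -- and total variation at most η.
    have h5 : n k * δ ^ 2 ≤ η ^ 2 / 2 := by nlinarith [sq_nonneg ε, sq_nonneg η]
    have h6 : 0 ≤ n k * δ ^ 2 := by positivity
    have h7 : n k * δ ^ 2 ≤ 1 := by nlinarith
    have h8 := Real.abs_exp_sub_one_le (x := n k * δ ^ 2) (by rwa [abs_of_nonneg h6])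
    rw [abs_of_nonneg h6] at h8
    linarith [le_abs_self (Real.exp (n k * δ ^ 2) - 1)]
  obtain ⟨i, S, hS, hkS, Q, hQ, h⟩ := exists_le_dataLaw_contaminated hs hsK k θ hTV
    (E := fun i => {z | δ / 32 ≤ paramDist (θhat k z) (θ i).disc}) (by
      rw [Set.eq_univ_iff_forall]
      intro z
      by_contra hz
      simp only [Set.mem_union, Set.mem_ofPred_eq, not_or, not_le] at hz
      have h1 := meanFam_sep (m := M / 2) (e := e) (v := 0) (v' := e) hδ0
        (by rw [zero_sub, norm_neg, he]; norm_num)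
      have h2 := paramDist_le (θhat k z) (θ false).disc (θ true).disc
      simp only [θ, if_true, Bool.false_eq_true, if_false] at h2 hz
      linarith [hz.1, hz.2])
  refine ⟨S, hS, _, const_mem_jointSpace hw0 hμ0 hβ0 (hθmem i), Q, hQ, h.trans (measure_mono ?_)⟩
  intro z hz
  rw [Set.mem_iUnion]
  refine ⟨⟨k, hkS⟩, ?_⟩
  have h1 := ht S hS
  have h2 : δ / 32 ≤ paramDist (θhat k z) (θ i).disc := hz
  change t S k ≤ _
  linarith

end rates

/-! ### The heterogeneity terms, the covariance bound and their assembly -/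

section bounds

variable {p K s : ℕ} {n : Fin K → ℕ} {M cw cS hw hμ hβ b : ℝ}

lemma exists_mem_jointSpace_w (hM : 0 < M) (hcw : 0 < cw) (hcS : 1 < cS) (hp : 0 < p) (hK : 0 < K)
    (hn : ∀ k, 0 < n k) (hw0 : 0 ≤ hw) (hμ0 : 0 ≤ hμ) (hβ0 : 0 ≤ hβ)
    (hb : 0 < b) (hbw : b < 1 / 2 - cw) (hb4 : 4 * b ^ 2 ≤ 1 / 400)
    {S A : Finset (Fin K)} (hAS : A ⊆ S) (hA : K ≤ 16 * A.card)
    (hAn : ∀ k ∈ A, 1 + Real.log K ≤ n k)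
    {t : Fin K → ℝ} (ht : ∀ k ∈ A, 32 * t k ≤ b * min hw (√((1 + Real.log K) / n k)))
    {θhat : Fin K → Data p n → DiscParam p} (hθ : ∀ k, Measurable (θhat k)) :
    ∃ θ ∈ jointSpace (p := p) M cw cS S hw hμ hβ,
      ∃ Q : Measure (OutlierData p n S), IsProbabilityMeasure Q ∧
        1 / 10 ≤ dataLaw n S θ Q
          (⋃ k : {k // k ∈ S}, {z | t k ≤ paramDist (θhat k z) (θ k).disc}) := by
  classical
  set e : EuclideanSpace ℝ (Fin p) := EuclideanSpace.single ⟨0, hp⟩ 1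
  have he : ‖e‖ = 1 := by simp [e]
  have hrt0 : ∀ k, 0 ≤ min hw (√((1 + Real.log K) / n k)) := fun k =>
    le_min hw0 (Real.sqrt_nonneg _)
  have hV : ∀ v ∈ insert (0 : ℝ) ({1, -1} : Finset ℝ), |v| ≤ 1 := by
    intro v hv
    simp only [Finset.mem_insert, Finset.mem_singleton] at hv
    rcases hv with rfl | rfl | rfl <;> norm_num
  -- The two signs form the packing, so q = 1 plays the role of the dimension.
  refine exists_mem_jointSpace_single hcw hK hn hw0 hμ0 hβ0 hb.le hb4
    hAS hA (V := {(1 : ℝ), -1}) (q := 1) le_rfl (by rw [Finset.card_pair (by norm_num)]; norm_num)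
    (by norm_num) (ϑ := wFam (M / 2) e) (θ₀ := wFam (M / 2) e 0 0) (by simp [wFam]) hrt0
    (fun k hk => (min_le_right _ _).trans (sqrt_div_le_one (hAn k hk)))
    (fun k _ => by simp)
    (fun r hr hrb v hv => wFam_mem (by linarith) (by linarith) hcS he hr (by linarith) (hV v hv))
    ?_
    (fun r hr hrb v hv => by
      have := wFam_chiBound (m := M / 2) (e := e) hr (by linarith)
        (hV v (Finset.mem_insert_of_mem hv))
      simpa [wFam] using this)
    (loss := fun k z ϑ => paramDist (θhat k z) ϑ.disc)
    (fun k ϑ => measurable_paramDist (hθ k) _)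
    (D := fun ϑ ϑ' => paramDist ϑ.disc ϑ'.disc)
    (fun k z ϑ ϑ' => paramDist_le _ _ _) ?_ ht
  · intro k hk v hv
    rw [wFam_beta, wFam_beta]
    refine ⟨?_, by simpa [wFam], by simpa [wFam], by simpa⟩
    have h1 : b * min hw (√((1 + Real.log K) / n k)) ≤ min hw (√((1 + Real.log K) / n k)) :=
      mul_le_of_le_one_left (hrt0 k) (by linarith)
    simp only [wFam, zero_mul, add_zero, add_sub_cancel_left]
    rw [abs_mul, abs_of_nonneg (mul_nonneg hb.le (hrt0 k))]
    exact (mul_le_of_le_one_right (mul_nonneg hb.le (hrt0 k)) (hV v hv)).trans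
      (h1.trans (min_le_left _ _))
  · intro r hr hrb v hv v' hv' hne
    refine wFam_sep hr ?_
    simp only [Finset.mem_insert, Finset.mem_singleton] at hv hv'
    rcases hv with rfl | rfl | rfl <;> rcases hv' with rfl | rfl | rfl <;>
      first | exact absurd rfl hne | norm_num

lemma exists_mem_jointSpace_mean (hcw : 0 < cw) (hcw' : cw < 1 / 2) (hcS : 1 < cS)
    (hp : 0 < p) (hK : 0 < K)
    (hn : ∀ k, 0 < n k) (hw0 : 0 ≤ hw) (hμ0 : 0 ≤ hμ) (hβ0 : 0 ≤ hβ)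
    (hb : 0 < b) (hb1 : b ≤ 1) (hbM : b ≤ M / 2) (hb4 : 4 * b ^ 2 ≤ 1 / 400)
    {S A : Finset (Fin K)} (hAS : A ⊆ S) (hA : K ≤ 16 * A.card)
    (hAn : ∀ k ∈ A, p + Real.log K ≤ n k)
    {t : Fin K → ℝ} (ht : ∀ k ∈ A, 32 * t k ≤ b * min hμ (√((p + Real.log K) / n k)))
    {θhat : Fin K → Data p n → DiscParam p} (hθ : ∀ k, Measurable (θhat k)) :
    ∃ θ ∈ jointSpace (p := p) M cw cS S hw hμ hβ,
      ∃ Q : Measure (OutlierData p n S), IsProbabilityMeasure Q ∧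
        1 / 10 ≤ dataLaw n S θ Q
          (⋃ k : {k // k ∈ S}, {z | t k ≤ paramDist (θhat k z) (θ k).disc}) := by
  classical
  obtain ⟨V, hVc, hV0, hV1, hVs⟩ := exists_packing hp
  set e : EuclideanSpace ℝ (Fin p) := EuclideanSpace.single ⟨0, hp⟩ 1
  have he : ‖e‖ = 1 := by simp [e]
  have hrt0 : ∀ k, 0 ≤ min hμ (√((p + Real.log K) / n k)) := fun k =>
    le_min hμ0 (Real.sqrt_nonneg _)
  have hV : ∀ v ∈ insert 0 V, ‖v‖ ≤ 1 := by
    intro v hv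
    rcases Finset.mem_insert.1 hv with rfl | hv
    · simp
    · exact hV1 v hv
  refine exists_mem_jointSpace_single hcw hK hn hw0 hμ0 hβ0 hb.le
    (κ := 1) (by nlinarith [sq_nonneg b]) hAS hA hp hVc.ge hV0 (ϑ := meanFam (M / 2) e)
    (θ₀ := meanFam (M / 2) e 0 0) (by simp [meanFam]) hrt0
    (fun k hk => (min_le_right _ _).trans (sqrt_div_le_one (hAn k hk)))
    (fun k _ => min_le_right _ _)
    (fun r hr hrb v hv => meanFam_mem (by linarith) hr (by linarith) hcw' hcS he (hV v hv))
    ?_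
    (fun r hr hrb v hv => by
      have := meanFam_chiBound (m := M / 2) (e := e) hr (hV v (Finset.mem_insert_of_mem hv))
      simpa [meanFam] using this)
    (loss := fun k z ϑ => paramDist (θhat k z) ϑ.disc)
    (fun k ϑ => measurable_paramDist (hθ k) _)
    (D := fun ϑ ϑ' => paramDist ϑ.disc ϑ'.disc)
    (fun k z ϑ ϑ' => paramDist_le _ _ _)
    (fun r hr hrb v hv v' hv' hne => meanFam_sep hr (hVs v hv v' hv' hne)) ht
  intro k hk v hv
  have h1 : ‖(b * min hμ (√((p + Real.log K) / n k))) • v‖ ≤ hμ := by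
    rw [norm_smul, Real.norm_of_nonneg (mul_nonneg hb.le (hrt0 k))]
    exact (mul_le_of_le_one_right (mul_nonneg hb.le (hrt0 k)) (hV v hv)).trans
      ((mul_le_of_le_one_left (hrt0 k) hb1).trans (min_le_left _ _))
  rw [meanFam_beta, meanFam_beta]
  refine ⟨by simpa [meanFam], ?_, ?_, by simpa⟩ <;> simpa [meanFam] using h1

/-- Only the precision moves, so w and the means agree exactly across tasks. At scale r/(2M), β
moves by at most r, which is clipped at h_β, and the χ² cost is r²/M² per observation. -/
lemma exists_mem_jointSpace_beta (hM : 0 < M) (hcw : 0 < cw) (hcw' : cw < 1 / 2) (hcS : 1 < cS)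
    (hp : 0 < p) (hK : 0 < K)
    (hn : ∀ k, 0 < n k) (hw0 : 0 ≤ hw) (hμ0 : 0 ≤ hμ) (hβ0 : 0 ≤ hβ)
    (hb : 0 < b) (hb1 : b ≤ 1) (hbM : b / (2 * M) ≤ 1 / 8) (hbS : 2 * (b / (2 * M)) ≤ 1 - cS⁻¹)
    (hb4 : 1 / M ^ 2 * b ^ 2 ≤ 1 / 400)
    {S A : Finset (Fin K)} (hAS : A ⊆ S) (hA : K ≤ 16 * A.card)
    (hAn : ∀ k ∈ A, p + Real.log K ≤ n k)
    {t : Fin K → ℝ} (ht : ∀ k ∈ A, 32 * t k ≤ b * min hβ (√((p + Real.log K) / n k)))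
    {θhat : Fin K → Data p n → DiscParam p} (hθ : ∀ k, Measurable (θhat k)) :
    ∃ θ ∈ jointSpace (p := p) M cw cS S hw hμ hβ,
      ∃ Q : Measure (OutlierData p n S), IsProbabilityMeasure Q ∧
        1 / 10 ≤ dataLaw n S θ Q
          (⋃ k : {k // k ∈ S}, {z | t k ≤ paramDist (θhat k z) (θ k).disc}) := by
  classical
  obtain ⟨V, hVc, hV0, hV1, hVs⟩ := exists_packing hp
  set e : EuclideanSpace ℝ (Fin p) := EuclideanSpace.single ⟨0, hp⟩ 1
  have he : ‖e‖ = 1 := by simp [e]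
  have hrt0 : ∀ k, 0 ≤ min hβ (√((p + Real.log K) / n k)) := fun k =>
    le_min hβ0 (Real.sqrt_nonneg _)
  have hV : ∀ v ∈ insert 0 V, ‖v‖ ≤ 1 := by
    intro v hv
    rcases Finset.mem_insert.1 hv with rfl | hv
    · simp
    · exact hV1 v hv
  have hscale : ∀ r, r ≤ b → r / (2 * M) ≤ b / (2 * M) := fun r hr => by gcongr
  refine exists_mem_jointSpace_single hcw hK hn hw0 hμ0 hβ0 hb.le hb4 hAS hA hp hVc.ge hV0
    (ϑ := fun r => covFam (M / 2) e (r / (2 * M)))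
    (θ₀ := covFam (M / 2) e 0 0) (by simp [covFam]) hrt0
    (fun k hk => (min_le_right _ _).trans (sqrt_div_le_one (hAn k hk)))
    (fun k _ => min_le_right _ _)
    (fun r hr hrb v hv => covFam_mem (by linarith) (by linarith) hcw' hcS he (hV v hv)
      (by positivity) ((hscale r hrb).trans hbM) (by linarith [hscale r hrb]))
    ?_
    (fun r hr hrb v hv => by
      have := covFam_chiBound (m := M / 2) he (hV v (Finset.mem_insert_of_mem hv))
        (by positivity) ((hscale r hrb).trans hbM)
      have h2 : 4 * (r / (2 * M)) ^ 2 = 1 / M ^ 2 * r ^ 2 := by field_simp; ring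
      rw [h2] at this
      simpa [covFam] using this)
    (loss := fun k z ϑ => paramDist (θhat k z) ϑ.disc)
    (fun k ϑ => measurable_paramDist (hθ k) _)
    (D := fun ϑ ϑ' => paramDist ϑ.disc ϑ'.disc)
    (fun k z ϑ ϑ' => paramDist_le _ _ _)
    (fun r hr hrb v hv v' hv' hne => covFam_sep hM hr ((hscale r hrb).trans hbM) he (hV v hv)
      (hV v' hv') (hVs v hv v' hv' hne)) ht
  intro k hk v hv
  set r := b * min hβ (√((p + Real.log K) / n k))
  have hr0 : 0 ≤ r := mul_nonneg hb.le (hrt0 k)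
  have hrb : r ≤ b := mul_le_of_le_one_right hb.le
    ((min_le_right _ _).trans (sqrt_div_le_one (hAn k hk)))
  refine ⟨by simpa [covFam], by simpa [covFam], by simpa [covFam], ?_⟩
  rw [covFam_beta he (hV v hv) (by positivity) ((hscale r hrb).trans hbM),
    covFam_beta he (by simp) le_rfl (by norm_num), ← smul_sub, norm_smul,
    mul_div_cancel₀ _ two_ne_zero, Real.norm_of_nonneg hM.le, precMat_zero, map_one]
  have h1 := norm_toEuclideanCLM_precMat_sub_le (by positivity : 0 ≤ r / (2 * M)) he (hV v hv) e
  rw [he, mul_one] at h1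
  calc M * _ ≤ M * (2 * (r / (2 * M))) := by gcongr; exact h1
    _ = r := by field_simp
    _ ≤ hβ := (mul_le_of_le_one_left (hrt0 k) hb1).trans (min_le_left _ _)

/-- Both means are zero, so β = 0 for every covariance and the joint space does not restrict Σ
across tasks; hence no minimum with an h appears. -/
lemma exists_mem_jointSpace_cov (hM : 0 < M) (hcw : 0 < cw) (hcw' : cw < 1 / 2) (hcS : 1 < cS)
    (hp : 0 < p) (hK : 0 < K)
    (hn : ∀ k, 0 < n k) (hw0 : 0 ≤ hw) (hμ0 : 0 ≤ hμ) (hβ0 : 0 ≤ hβ)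
    (hb : 0 < b) (hb1 : b ≤ 1 / 8) (hbS : 2 * b ≤ 1 - cS⁻¹) (hb4 : 4 * b ^ 2 ≤ 1 / 400)
    {S : Finset (Fin K)} (hS : K ≤ 16 * S.card) (hSn : ∀ k ∈ S, p + Real.log K ≤ n k)
    {t : Fin K → ℝ} (ht : ∀ k ∈ S, 32 * t k ≤ b * √((p + Real.log K) / n k))
    {Shat : Fin K → Data p n → Matrix (Fin p) (Fin p) ℝ}
    (hShat : ∀ k i j, Measurable fun z => Shat k z i j) :
    ∃ θ ∈ jointSpace (p := p) M cw cS S hw hμ hβ,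
      ∃ Q : Measure (OutlierData p n S), IsProbabilityMeasure Q ∧
        1 / 10 ≤ dataLaw n S θ Q
          (⋃ k : {k // k ∈ S}, {z | t k ≤ specNorm (Shat k z - (θ k).cov)}) := by
  classical
  obtain ⟨V, hVc, hV0, hV1, hVs⟩ := exists_packing hp
  set e : EuclideanSpace ℝ (Fin p) := EuclideanSpace.single ⟨0, hp⟩ 1
  have he : ‖e‖ = 1 := by simp [e]
  have hV : ∀ v ∈ insert 0 V, ‖v‖ ≤ 1 := by
    intro v hv
    rcases Finset.mem_insert.1 hv with rfl | hv
    · simp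
    · exact hV1 v hv
  refine exists_mem_jointSpace_single hcw hK hn hw0 hμ0 hβ0 hb.le
    hb4 (Finset.Subset.refl S) hS hp hVc.ge hV0 (ϑ := covFam 0 e)
    (θ₀ := covFam 0 e 0 0) (by simp [covFam]) (fun k => Real.sqrt_nonneg _)
    (fun k hk => sqrt_div_le_one (hSn k hk)) (fun k _ => le_rfl)
    (fun r hr hrb v hv => covFam_mem le_rfl hM.le hcw' hcS he (hV v hv) hr (by linarith)
      (by linarith))
    ?_
    (fun r hr hrb v hv => by
      have := covFam_chiBound (m := 0) he (hV v (Finset.mem_insert_of_mem hv)) hr (by linarith)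
      simpa [covFam] using this)
    (loss := fun k z ϑ => specNorm (Shat k z - ϑ.cov))
    (fun k ϑ => measurable_specNorm_sub (hShat k) _)
    (D := fun ϑ ϑ' => specNorm (ϑ.cov - ϑ'.cov))
    (fun k z ϑ ϑ' => specNorm_sub_le _ _ _)
    (fun r hr hrb v hv v' hv' hne => ?_) ht
  · intro k hk v hv
    have hrb : b * √((p + Real.log K) / n k) ≤ b :=
      mul_le_of_le_one_right hb.le (sqrt_div_le_one (hSn k hk))
    refine ⟨by simpa [covFam], by simpa [covFam], by simpa [covFam], ?_⟩
    rw [covFam_beta he (hV v hv) (by positivity) (by linarith),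
      covFam_beta he (by simp) le_rfl (by norm_num)]
    simpa
  · have h1 := specNorm_inv_precMat_sub hr (by linarith) he (hV v hv) (hV v' hv')
    have h2 := hVs v hv v' hv' hne
    change r ≤ 16 * specNorm ((precMat e r v)⁻¹ - (precMat e r v')⁻¹)
    nlinarith

/-- The lower bound for `(w, μ₁, μ₂, β)`, with the task set and the parameters made explicit. -/
lemma exists_mem_jointSpace_disc (hM : 0 < M) (hcw : 0 < cw) (hcw' : cw < 1 / 2) (hcS : 1 < cS)
    (hp : 0 < p) (hs : 0 < s) (hsK : s ≤ K) (hn : ∀ k, 0 < n k)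
    (hw0 : 0 ≤ hw) (hμ0 : 0 ≤ hμ) (hβ0 : 0 ≤ hβ) (hc : ((K : ℝ) - s) / s < 1 / 4)
    (hb : 0 < b) (hb1 : b ≤ 1) (hbw : b < 1 / 2 - cw) (hbM : b ≤ M / 2)
    (hbM' : b / (2 * M) ≤ 1 / 8) (hbS : 2 * (b / (2 * M)) ≤ 1 - cS⁻¹)
    (hbκ : (4 + 1 / M ^ 2) * b ^ 2 ≤ 1 / 400)
    {S₀ : Finset (Fin K)} (hS₀ : s ≤ S₀.card) (hS₀n : ∀ k ∈ S₀, (p : ℝ) + Real.log K ≤ n k)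
    {θhat : Fin K → Data p n → DiscParam p} (hθ : ∀ k, Measurable (θhat k)) :
    ∃ S : Finset (Fin K), s ≤ S.card ∧ ∃ θ ∈ jointSpace (p := p) M cw cS S hw hμ hβ,
      ∃ Q : Measure (OutlierData p n S), IsProbabilityMeasure Q ∧
        1 / 10 ≤ dataLaw n S θ Q (⋃ k : {k // k ∈ S},
          {z | b / 160 * rate p s n hw hμ hβ S k ≤ paramDist (θhat k z) (θ k).disc}) := by
  classical
  have hK : 0 < K := hs.trans_le hsK
  have hs0 : (0 : ℝ) < s := by exact_mod_cast hs
  have hlogK : 0 ≤ Real.log K := Real.log_natCast_nonneg K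
  have hb4 : 4 * b ^ 2 ≤ 1 / 400 := by
    have : 0 ≤ 1 / M ^ 2 * b ^ 2 := by positivity
    linarith
  have hb4' : 1 / M ^ 2 * b ^ 2 ≤ 1 / 400 := by nlinarith [sq_nonneg b]
  -- Minimising n_S over admissible sets maximises the rate, which matters because the contamination
  -- argument does not let S be chosen.
  obtain ⟨S₁, hS₁, hmin⟩ := Finset.exists_min_image
    ((Finset.univ : Finset (Finset (Fin K))).filter fun S => s ≤ S.card)
    (fun S => ∑ j ∈ S, n j) ⟨S₀, by simpa using hS₀⟩
  simp only [Finset.mem_filter, Finset.mem_univ, true_and] at hS₁ hmin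
  set F := S₀ ∩ S₁
  have hFS : F ⊆ S₁ := Finset.inter_subset_right
  have hFn : ∀ k ∈ F, (p : ℝ) + Real.log K ≤ n k := fun k hk =>
    hS₀n k (Finset.mem_inter.1 hk).1
  -- Two sets of size at least s meet in at least 2s − K tasks, and s > 4K/5 makes this exceed 3K/5.
  have hFcard : K ≤ 2 * F.card := by
    have h1 := Finset.card_union_add_card_inter S₀ S₁
    have h2 : (S₀ ∪ S₁).card ≤ K := by simpa using (S₀ ∪ S₁).card_le_univ
    have h3 : 4 * K < 5 * s := by
      rw [div_lt_iff₀ hs0] at hc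
      have : (4 : ℝ) * K < 5 * s := by linarith
      exact_mod_cast this
    have h4 : F.card = (S₀ ∩ S₁).card := rfl
    omega
  set R := rate p s n hw hμ hβ S₁
  have hp1 : (1 : ℝ) ≤ p := by exact_mod_cast hp
  by_cases h1 : ∃ k ∈ F, R k ≤ 5 * √((p : ℝ) / ((∑ j ∈ S₁, n j : ℕ) : ℝ))
  · obtain ⟨k, hk, hR⟩ := h1
    have hpn : p ≤ n k := by
      have : (p : ℝ) ≤ n k := by linarith [hFn k hk]
      exact_mod_cast this
    exact ⟨S₁, hS₁, exists_mem_jointSpace_common hp hcw hcw' hcS hw0 hμ0 hβ0 hb hbM hb4 (hFS hk) hpn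
      (t := fun k => b / 160 * R k)
      (by nlinarith) hθ⟩
  by_cases h2 : ∃ k ∈ F, R k ≤ 5 * ((((K : ℝ) - s) / s) / √((Finset.univ.sup n : ℕ) : ℝ))
  · obtain ⟨k, hk, hR⟩ := h2
    have hNS : ∀ S : Finset (Fin K), s ≤ S.card → 0 < ∑ j ∈ S, n j := fun S hS =>
      Finset.sum_pos (fun k _ => hn k) (Finset.card_pos.1 (by omega))
    -- When s = K the contamination term is zero and cannot dominate the positive rate.
    have hsK' : s < K := by
      refine lt_of_le_of_ne hsK fun h => ?_
      rw [h, sub_self, zero_div, zero_div, mul_zero] at hR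
      have hN : (0 : ℝ) < ((∑ j ∈ S₁, n j : ℕ) : ℝ) := by exact_mod_cast hNS S₁ hS₁
      have hpos : 0 < R k := by
        simp only [R, rate, h, sub_self, zero_div, add_zero]
        have : 0 < √((p : ℝ) / ((∑ j ∈ S₁, n j : ℕ) : ℝ)) := Real.sqrt_pos.2 (by positivity)
        have := le_min hw0 (Real.sqrt_nonneg ((1 + Real.log K) / n k))
        have := le_min hμ0 (Real.sqrt_nonneg ((p + Real.log K) / n k))
        have := le_min hβ0 (Real.sqrt_nonneg ((p + Real.log K) / n k))
        linarith
      linarith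
    refine exists_mem_jointSpace_contaminated hp hs hsK' hc hn hcw hcw' hcS hw0 hμ0 hβ0 hb hbM hb4 k
      (t := fun S k => b / 160 * rate p s n hw hμ hβ S k) (fun S hS => ?_) θhat
    -- The set S comes out of the contamination argument; minimality of S₁ bounds its rate by R.
    have hle : rate p s n hw hμ hβ S k ≤ R k := by
      have hN : (0 : ℝ) < ((∑ j ∈ S₁, n j : ℕ) : ℝ) := by exact_mod_cast hNS S₁ hS₁
      have hNle : ((∑ j ∈ S₁, n j : ℕ) : ℝ) ≤ ((∑ j ∈ S, n j : ℕ) : ℝ) := by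
        exact_mod_cast hmin S hS
      simp only [R, rate]
      gcongr
    nlinarith
  push Not at h1 h2
  set A₃ := F.filter fun k => R k ≤ 5 * min hw (√((1 + Real.log K) / n k))
  set A₄ := F.filter fun k => R k ≤ 5 * min hμ (√((p + Real.log K) / n k))
  set A₅ := F.filter fun k => R k ≤ 5 * min hβ (√((p + Real.log K) / n k))
  have hsub : F ⊆ A₃ ∪ (A₄ ∪ A₅) := by
    intro k hk
    simp only [A₃, A₄, A₅, Finset.mem_union, Finset.mem_filter, hk, true_and]
    rcases rate_le_or (p := p) (s := s) (n := n) (hw := hw) (hμ := hμ) (hβ := hβ) (S := S₁) k with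
      h | h | h
    · exact absurd h (not_le.2 (h1 k hk))
    · exact absurd h (not_le.2 (h2 k hk))
    · exact h
  have hcard := (Finset.card_le_card hsub).trans ((Finset.card_union_le _ _).trans
    (Nat.add_le_add_left (Finset.card_union_le _ _) _))
  -- One of the three classes holds a third of F, thus at least K/6 tasks.
  have h3 : K ≤ 16 * A₃.card ∨ K ≤ 16 * A₄.card ∨ K ≤ 16 * A₅.card := by omega
  refine ⟨S₁, hS₁, ?_⟩
  rcases h3 with h | h | h
  · refine exists_mem_jointSpace_w (t := fun k => b / 160 * R k)
      hM hcw hcS hp hK hn hw0 hμ0 hβ0 hb hbw hb4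
      ((Finset.filter_subset _ _).trans hFS) h
      (fun k hk => by linarith [hFn k (Finset.mem_filter.1 hk).1]) (fun k hk => ?_) hθ
    have := (Finset.mem_filter.1 hk).2
    nlinarith
  · refine exists_mem_jointSpace_mean (t := fun k => b / 160 * R k)
      hcw hcw' hcS hp hK hn hw0 hμ0 hβ0 hb hb1 hbM hb4
      ((Finset.filter_subset _ _).trans hFS) h
      (fun k hk => hFn k (Finset.mem_filter.1 hk).1) (fun k hk => ?_) hθ
    have := (Finset.mem_filter.1 hk).2
    nlinarith
  · refine exists_mem_jointSpace_beta (t := fun k => b / 160 * R k)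
      hM hcw hcw' hcS hp hK hn hw0 hμ0 hβ0 hb hb1 hbM' hbS hb4'
      ((Finset.filter_subset _ _).trans hFS) h
      (fun k hk => hFn k (Finset.mem_filter.1 hk).1) (fun k hk => ?_) hθ
    have := (Finset.mem_filter.1 hk).2
    nlinarith

end bounds

/-! ### The minimax lower bounds -/

theorem theorem2 (M cw cS : ℝ) (hM : 0 < M) (hcw : 0 < cw) (hcw' : cw < 1 / 2) (hcS : 1 < cS) :
    ∃ c > (0 : ℝ), ∃ C > (0 : ℝ), ∃ C₁ > (0 : ℝ),
      ∀ (p K s : ℕ) (n : Fin K → ℕ) (hw hμ hβ : ℝ),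
        0 < p → 0 < s → s ≤ K → (∀ k, 0 < n k) → 0 ≤ hw → 0 ≤ hμ → 0 ≤ hβ →
        ((K : ℝ) - s) / s < c →
        (∃ S : Finset (Fin K), s ≤ S.card ∧ ∀ k ∈ S, C * (p + Real.log K) ≤ n k) →
        ((1 / 10 : ℝ≥0∞) ≤
          ⨅ (θhat : Fin K → Data p n → DiscParam p) (_ : ∀ k, Measurable (θhat k)),
            ⨆ (S : Finset (Fin K)) (_ : s ≤ S.card)
              (θ : {k // k ∈ S} → GMMParam p) (_ : θ ∈ jointSpace M cw cS S hw hμ hβ)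
              (Q : Measure (OutlierData p n S)) (_ : IsProbabilityMeasure Q),
              dataLaw n S θ Q
                (⋃ k : {k // k ∈ S},
                  {z | C₁ * rate p s n hw hμ hβ S k ≤ paramDist (θhat k z) (θ k).disc})) ∧
        ((1 / 10 : ℝ≥0∞) ≤
          ⨅ (Shat : Fin K → Data p n → Matrix (Fin p) (Fin p) ℝ)
            (_ : ∀ k i j, Measurable fun z => Shat k z i j),
            ⨆ (S : Finset (Fin K)) (_ : s ≤ S.card)
              (θ : {k // k ∈ S} → GMMParam p) (_ : θ ∈ jointSpace M cw cS S hw hμ hβ)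
              (Q : Measure (OutlierData p n S)) (_ : IsProbabilityMeasure Q),
              dataLaw n S θ Q
                (⋃ k : {k // k ∈ S},
                  {z | C₁ * √((p + Real.log K) / n k) ≤ specNorm (Shat k z - (θ k).cov)})) := by
  obtain ⟨b, hb, hbw, hbM, hbM', hbS', hb8, hbS, hbκ⟩ := exists_scale hM hcw' hcS
  refine ⟨1 / 4, by norm_num, 1, one_pos, b / 160, by positivity, ?_⟩
  rintro p K s n hw hμ hβ hp hs hsK hn hw0 hμ0 hβ0 hc ⟨S₀, hS₀, hS₀n⟩
  simp only [one_mul] at hS₀n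
  refine ⟨le_iInf₂ fun θhat hθ => ?_, le_iInf₂ fun Shat hShat => ?_⟩
  · obtain ⟨S, hS, θ, hθS, Q, hQ, h⟩ := exists_mem_jointSpace_disc hM hcw hcw' hcS hp hs hsK hn
      hw0 hμ0 hβ0 hc hb (by linarith) hbw hbM hbM' hbS' hbκ hS₀ hS₀n hθ
    exact h.trans <| le_iSup₂_of_le S hS <| le_iSup₂_of_le θ hθS <| le_iSup₂_of_le Q hQ le_rfl
  · have hs0 : (0 : ℝ) < s := by exact_mod_cast hs
    -- For the covariance every task of S₀ may be perturbed, and s is already at least K/2.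
    have hcard : K ≤ 16 * S₀.card := by
      rw [div_lt_iff₀ hs0] at hc
      have : (K : ℝ) ≤ 2 * s := by linarith
      have : K ≤ 2 * s := by exact_mod_cast this
      omega
    have hb4 : 4 * b ^ 2 ≤ 1 / 400 := by
      have : 0 ≤ 1 / M ^ 2 * b ^ 2 := by positivity
      linarith
    obtain ⟨θ, hθS, Q, hQ, h⟩ := exists_mem_jointSpace_cov (t := fun k =>
      b / 160 * √((p + Real.log K) / n k)) hM hcw hcw' hcS hp (hs.trans_le hsK) hn hw0 hμ0 hβ0 hb
      hb8 hbS hb4 hcard hS₀n (fun k _ => by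
        have : 0 ≤ b * √((p + Real.log K) / n k) := by positivity
        nlinarith) hShat
    exact h.trans <| le_iSup₂_of_le S₀ hS₀ <| le_iSup₂_of_le θ hθS <| le_iSup₂_of_le Q hQ le_rfl
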